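/- Let $H$ be a Hermitian operator (the Hamiltonian) and $\rho$ a density matrix on a finite-dimensional Hilbert space $\mathcal H$. Let $\mathcal C=\{P_i\}$ be a finite family of mutually orthogonal Hermitian projectors with $\sum_i P_i=I$. Put $p_i=\mathrm{tr}[P_i\rho]$, $V_i=\mathrm{tr}[P_i]$, $\rho_{\mathrm{cg}}=\sum_i \frac{p_i}{V_i}P_i$ and $S_{\mathcal C}=-\sum_i p_i\ln p_i+\sum_i p_i\ln V_i$ (the observational entropy). Consider the following protocol on $\rho^{\otimes N}$, with Hamiltonian $H_N=\sum_{k=1}^N I\otimes\cdots\otimes H\otimes\cdots\otimes I$ ($H$ acting on the $k$-th copy). On each copy $k$ a random block unitary $\tilde V_k=\bigoplus_i\tilde U_i^{(k)}$ is applied, where $\tilde U_i^{(k)}$ is a unitary on the range of $P_i$; the $\tilde V_k$ are drawn independently from the normalized Haar measure on the group of such block unitaries. Then a fixed unitary $U$ on $\mathcal H^{\otimes N}$ is applied to all copies. With $\tilde V=\tilde V_1\otimes\cdots\otimes\tilde V_N$, the average extracted work is $$\overline W_N(\rho,U)=\int\Big(\mathrm{tr}[H_N\rho^{\otimes N}]-\mathrm{tr}[H_N\,U\tilde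 V\rho^{\otimes N}\tilde V^\dagger U^\dagger]\Big)\,d\mu(\tilde V_1)\cdots d\mu(\tilde V_N),$$ and $W_{\mathcal C}(\rho^{\otimes N})=\max_U\overline W_N(\rho,U)$. A thermal state of $H$ is $\rho_\beta=e^{-\beta H}/\mathrm{tr}[e^{-\beta H}]$ with $0\le\beta<\infty$, or the limit of these states as $\beta\to\infty$ ($\beta=\infty$). Let $S_{\mathrm{vN}}(\sigma)=-\mathrm{tr}[\sigma\ln\sigma]$, with $0\ln0=0$. Then: 1. $S_{\mathrm{vN}}(\rho_{\mathrm{cg}})=S_{\mathcal C}$. 2. For every $N$ the maximum over $U$ is attained, and by a unitary that depends only on the outcome probabilities: there is one $U$ such that $\overline W_N(\rho',U)=\max_{U'}\overline W_N(\rho',U')$ for every density matrix $\rho'$ with $\mathrm{tr}[P_i\rho']=p_i$ for all $i$. 3. If $S_{\mathcal C}\ge\ln g_0$, where $g_0$ is the multiplicity of the smallest eigenvalue of $H$ (so always, if the ground state is non-degenerate), there is exactly one thermal state $\rho_{\beta'}$ of $H$ with $S_{\mathrm{vN}}(\rho_{\beta'})=S_{\mathcal C}$. 4. If $\rho_{\beta'}$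 is a thermal state of $H$ with $S_{\mathrm{vN}}(\rho_{\beta'})=S_{\mathcal C}$, then $$\lim_{N\to\infty}\frac{W_{\mathcal C}(\rho^{\otimes N})}{N}=\mathrm{tr}[H(\rho-\rho_{\beta'})].$$ -/

import Mathlib

open Filter Topology MeasureTheory
open scoped Matrix ComplexOrder

noncomputable section

namespace ObsErgo

/-- A density matrix on `ℂ^d`: positive semidefinite with unit trace. -/
structure IsDensityMatrix {d : Type*} [Fintype d] (ρ : Matrix d d ℂ) : Prop where
  posSemidef : ρ.PosSemidef
  trace_eq_one : ρ.trace = 1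

/-- The energy `tr[H ρ]` (real for Hermitian `H` and `ρ`). -/
def energy {d : Type*} [Fintype d] (H ρ : Matrix d d ℂ) : ℝ := (H * ρ).trace.re

/-- The von Neumann entropy `-tr[ρ ln ρ]` of a Hermitian matrix, `ρ ln ρ` being given by the
functional calculus (with `0 ln 0 = 0`). -/
def vnEntropy {d : Type*} [Fintype d] [DecidableEq d] (ρ : Matrix d d ℂ) : ℝ :=
  (cfc Real.negMulLog ρ).trace.re

/-! ### Coarse-grainings -/

/-- A coarse-graining (projective measurement): a family of mutually orthogonal Hermitian projectors
that sum to the identity. -/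
structure CoarseGraining (d ι : Type*) [Fintype d] [DecidableEq d] [Fintype ι] where
  proj : ι → Matrix d d ℂ
  isHermitian : ∀ i, (proj i).IsHermitian
  complete : CompleteOrthogonalIdempotents proj

namespace CoarseGraining

variable {d ι : Type*} [Fintype d] [DecidableEq d] [Fintype ι] (C : CoarseGraining d ι)

/-- The probability `p_i = tr[P_i ρ]` of outcome `i`. -/
def prob (ρ : Matrix d d ℂ) (i : ι) : ℝ := (C.proj i * ρ).trace.re

/-- The volume `V_i = tr[P_i]` of the macrostate `i`, the dimension of its subspace. -/
def vol (i : ι) : ℝ := (C.proj i).trace.re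

/-- The coarse-grained state `∑ i, (p_i / V_i) P_i`. -/
def coarseState (ρ : Matrix d d ℂ) : Matrix d d ℂ :=
  ∑ i, ((C.prob ρ i / C.vol i : ℝ) : ℂ) • C.proj i

/-- The observational entropy `-∑ i, p_i ln p_i + ∑ i, p_i ln V_i`. -/
def obsEntropy (ρ : Matrix d d ℂ) : ℝ :=
  -∑ i, C.prob ρ i * Real.log (C.prob ρ i) + ∑ i, C.prob ρ i * Real.log (C.vol i)

/-- The group of the unitaries `⨁ i, Ũ_i` with `Ũ_i` unitary on the range of `P_i`: the
unitaries that commute with every `P_i`. -/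
def blockUnitary : Subgroup (Matrix.unitaryGroup d ℂ) where
  carrier := {U | ∀ i, Commute (U : Matrix d d ℂ) (C.proj i)}
  one_mem' := fun i => Commute.one_left (C.proj i)
  mul_mem' := fun ha hb i => (ha i).mul_left (hb i)
  inv_mem' := by
    intro U hU i
    have h := congrArg star (hU i).eq
    have hP : star (C.proj i) = C.proj i := C.isHermitian i
    rw [star_mul, star_mul, hP] at h
    exact h.symm

instance : CompactSpace C.blockUnitary := by
  have hemb : IsClosedEmbedding
      (fun U : C.blockUnitary => ((U : Matrix.unitaryGroup d ℂ) : Matrix d d ℂ)) := by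
    refine ⟨(IsEmbedding.subtypeVal).comp IsEmbedding.subtypeVal, ?_⟩
    have hr : Set.range (fun U : C.blockUnitary =>
          ((U : Matrix.unitaryGroup d ℂ) : Matrix d d ℂ)) =
        {A : Matrix d d ℂ | star A * A = 1} ∩ ({A : Matrix d d ℂ | A * star A = 1} ∩
          ⋂ i, {A : Matrix d d ℂ | A * C.proj i = C.proj i * A}) := by
      ext A
      constructor
      · rintro ⟨U, rfl⟩
        exact ⟨U.1.2.1, U.1.2.2, Set.mem_iInter.2 fun i => (U.2 i).eq⟩
      · rintro ⟨h1, h2, h3⟩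
        exact ⟨⟨⟨A, ⟨h1, h2⟩⟩, fun i => Set.mem_iInter.1 h3 i⟩, rfl⟩
    rw [hr]
    exact (isClosed_eq (by fun_prop) continuous_const).inter
      ((isClosed_eq (by fun_prop) continuous_const).inter
        (isClosed_iInter fun i => isClosed_eq (by fun_prop) (by fun_prop)))
  have hc : IsCompact (Set.pi Set.univ fun _ : d => Set.pi Set.univ fun _ : d =>
      Metric.closedBall (0 : ℂ) 1) :=
    isCompact_univ_pi fun _ => isCompact_univ_pi fun _ => isCompact_closedBall (0 : ℂ) 1
  refine ⟨(hemb.isCompact_preimage hc).of_isClosed_subset isClosed_univ ?_⟩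
  intro U _ a _ b _
  rw [mem_closedBall_zero_iff]
  exact entry_norm_bound_of_unitary U.1.2 a b

instance : MeasurableSpace C.blockUnitary := borel _

instance : BorelSpace C.blockUnitary := ⟨rfl⟩

/-- The normalized Haar measure on the group of block unitaries. -/
def haarProb : Measure C.blockUnitary := Measure.haarMeasure ⊤

instance : IsProbabilityMeasure C.haarProb :=
  ⟨Measure.haarMeasure_self (K₀ := (⊤ : TopologicalSpace.PositiveCompacts C.blockUnitary))⟩

end CoarseGraining

/-! ### Many copies -/

variable {d ι : Type*} [Fintype d] [DecidableEq d] [Fintype ι]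

/-- The tensor product `A 0 ⊗ ⋯ ⊗ A (N - 1)` on `(ℂ^d)^{⊗ N}`, whose basis is indexed by
`Fin N → d`. -/
def tensor {N : ℕ} (A : Fin N → Matrix d d ℂ) : Matrix (Fin N → d) (Fin N → d) ℂ :=
  Matrix.of fun x y => ∏ k, A k (x k) (y k)

/-- `H_N = ∑ k, 1 ⊗ ⋯ ⊗ H ⊗ ⋯ ⊗ 1`, with `H` at place `k`. -/
def totalHamiltonian (H : Matrix d d ℂ) (N : ℕ) : Matrix (Fin N → d) (Fin N → d) ℂ :=
  ∑ k : Fin N, tensor (Function.update (fun _ => 1) k H)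

/-- The work extracted from `ρ^{⊗ N}` in a single run: the initial minus the final energy with
respect to `H_N`, after the block unitaries `V k` have been applied to the copies `k`, and then
the global unitary `U` to all of them. -/
def singleRunWork (H : Matrix d d ℂ) (C : CoarseGraining d ι) (ρ : Matrix d d ℂ) (N : ℕ)
    (U : Matrix.unitaryGroup (Fin N → d) ℂ) (V : Fin N → C.blockUnitary) : ℝ :=
  energy (totalHamiltonian H N) (tensor fun _ => ρ) -
    energy (totalHamiltonian H N)
      ((U : Matrix (Fin N → d) (Fin N → d) ℂ) *
        (tensor (fun k => ((V k : Matrix.unitaryGroup d ℂ) : Matrix d d ℂ)) *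
          (tensor fun _ => ρ) *
          (tensor (fun k => ((V k : Matrix.unitaryGroup d ℂ) : Matrix d d ℂ)))ᴴ) *
        (U : Matrix (Fin N → d) (Fin N → d) ℂ)ᴴ)

/-- The average of the extracted work when the block unitaries of the copies are drawn
independently from the normalized Haar measure. -/
def averageWork (H : Matrix d d ℂ) (C : CoarseGraining d ι) (ρ : Matrix d d ℂ) (N : ℕ)
    (U : Matrix.unitaryGroup (Fin N → d) ℂ) : ℝ :=
  ∫ V, singleRunWork H C ρ N U V ∂(Measure.pi fun _ : Fin N => C.haarProb)

/-- The observational ergotropy of `N` copies: the largest average work over all global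
unitaries `U`. -/
def obsErgotropy (H : Matrix d d ℂ) (C : CoarseGraining d ι) (ρ : Matrix d d ℂ) (N : ℕ) : ℝ :=
  ⨆ U : Matrix.unitaryGroup (Fin N → d) ℂ, averageWork H C ρ N U

/-! ### Thermal states -/

/-- The Gibbs state `e^{-β H} / tr[e^{-β H}]`. -/
def gibbs (H : Matrix d d ℂ) (β : ℝ) : Matrix d d ℂ :=
  (NormedSpace.exp (-(β : ℂ) • H)).trace⁻¹ • NormedSpace.exp (-(β : ℂ) • H)

/-- `σ` is the Gibbs state of `H` at some inverse temperature `β ∈ [0, ∞]`; the one at `β = ∞` is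
the limit of the Gibbs states as `β → ∞`. -/
def IsThermal (H σ : Matrix d d ℂ) : Prop :=
  (∃ β : ℝ, 0 ≤ β ∧ σ = gibbs H β) ∨ Tendsto (gibbs H) atTop (𝓝 σ)

/-- The multiplicity of the smallest eigenvalue of `H`. -/
def groundDegeneracy {H : Matrix d d ℂ} (hH : H.IsHermitian) : ℕ :=
  Nat.card {i : d // ∀ j, hH.eigenvalues i ≤ hH.eigenvalues j}

end ObsErgo

end

/-! Averaging over the block unitaries turns the quantum protocol into a fixed unitary problem. By
left invariance of Haar measure the average of `V ρ Vᴴ` commutes with every block unitary, so it is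
a scalar on the range of each projector (`vol_smul_mul_proj`); its outcome probabilities are those
of ρ, so it is the coarse-grained state (`twirl_eq_coarseState`). The copies being independent, the
average work is `N tr[Hρ]` minus the energy of `U ρ_cg^{⊗N} Uᴴ` (`averageWork_eq`). Only the second
term involves `U`, and it sees ρ only through the probabilities; compactness of the unitary group
gives an optimal `U`.

After diagonalization, the limit concerns a product vector `p^N` and additive energies. No unitary
can bring the energy per copy below that of the thermal state of equal entropy: the squared moduli
of the entries of a unitary form a doubly stochastic matrix, and Klein's inequality against the
Gibbs vector gives the bound exactly for every N (`mul_expect_le_energy`).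

The bound is nearly reached by permuting an eigenbasis. Perturb the thermal vector to a positive `q`
of slightly larger entropy and nearly the same energy. The typical sequences of `p`, about `exp (N
S(p))` of them, are then fewer than the low-energy typical sequences of `q`, so a permutation
carries the former into the latter (`exists_perm_energy_le`).

Thermal states of given entropy exist by the intermediate value theorem in β and are unique by the
equality case of Gibbs' inequality. -/

noncomputable section

namespace ObsErgo

/-! ### Finite probability vectors -/

section Classical

variable {α : Type*} [Fintype α]

/-- A probability vector on a finite type. -/
structure IsProbVec (p : α → ℝ) : Prop where
  nonneg : ∀ a, 0 ≤ p a
  sum_eq_one : ∑ a, p a = 1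

/-- The Shannon entropy of a vector. -/
def shannon (p : α → ℝ) : ℝ := ∑ a, Real.negMulLog (p a)

/-- The expectation of `f` under `p`. -/
def expect (p f : α → ℝ) : ℝ := ∑ a, p a * f a

/-- This is `log t ≤ t - 1` at `t = g / p`, multiplied by `p`. Summed with suitable weights it
yields both Gibbs' and Klein's inequalities, and its strict form yields the equality case. -/
lemma negMulLog_add_mul_log_le {p g : ℝ} (hp : 0 ≤ p) (hg : 0 < g) :
    Real.negMulLog p + p * Real.log g ≤ g - p := by
  rcases hp.eq_or_lt with rfl | hp
  · simpa using hg.le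
  · have h := Real.log_le_sub_one_of_pos (div_pos hg hp)
    rw [Real.log_div hg.ne' hp.ne'] at h
    have h2 := mul_le_mul_of_nonneg_left h hp.le
    have h3 : p * (g / p - 1) = g - p := by field_simp
    rw [h3] at h2
    rw [Real.negMulLog]
    linarith

lemma eq_of_negMulLog_add_mul_log_eq {p g : ℝ} (hp : 0 ≤ p) (hg : 0 < g)
    (h : Real.negMulLog p + p * Real.log g = g - p) : p = g := by
  rcases hp.eq_or_lt with rfl | hp
  · simp at h; linarith
  · by_contra hne
    have h1 := Real.log_lt_sub_one_of_pos (div_pos hg hp)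
      (fun h1 => hne ((div_eq_one_iff_eq hp.ne').1 h1).symm)
    rw [Real.log_div hg.ne' hp.ne'] at h1
    have h2 := mul_lt_mul_of_pos_left h1 hp
    have h3 : p * (g / p - 1) = g - p := by field_simp
    rw [h3] at h2
    rw [Real.negMulLog] at h
    linarith

/-- Klein's inequality for a doubly stochastic transition matrix. -/
lemma shannon_le_of_doublyStochastic {β : Type*} [Fintype β] {M : β → α → ℝ} {p : α → ℝ}
    {g : β → ℝ} (hM : ∀ y x, 0 ≤ M y x) (hrow : ∀ y, ∑ x, M y x = 1) (hcol : ∀ x, ∑ y, M y x = 1)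
    (hp : IsProbVec p) (hg : IsProbVec g) (hpos : ∀ y, 0 < g y) :
    shannon p ≤ ∑ x, ∑ y, M y x * p x * -Real.log (g y) := by
  have h1 : ∑ x, ∑ y, M y x * (Real.negMulLog (p x) + p x * Real.log (g y)) ≤
      ∑ x, ∑ y, M y x * (g y - p x) :=
    Finset.sum_le_sum fun x _ => Finset.sum_le_sum fun y _ =>
      mul_le_mul_of_nonneg_left (negMulLog_add_mul_log_le (hp.nonneg x) (hpos y)) (hM y x)
  -- Row sums collapse the `g` part and column sums the `p` part, each to total mass 1.
  have h2 : ∑ x, ∑ y, M y x * (g y - p x) = 0 := by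
    simp_rw [mul_sub, Finset.sum_sub_distrib, ← Finset.sum_mul, hcol, one_mul]
    rw [Finset.sum_comm]
    simp_rw [← Finset.sum_mul, hrow, one_mul, hp.sum_eq_one, hg.sum_eq_one, sub_self]
  have h3 : ∑ x, ∑ y, M y x * (Real.negMulLog (p x) + p x * Real.log (g y)) =
      shannon p - ∑ x, ∑ y, M y x * p x * -Real.log (g y) := by
    simp_rw [mul_add, Finset.sum_add_distrib, ← Finset.sum_mul, hcol, one_mul, shannon]
    simp only [mul_neg, Finset.sum_neg_distrib, sub_neg_eq_add, mul_assoc]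
  linarith

/-- Gibbs' inequality. -/
lemma shannon_le_expect_log {p g : α → ℝ} (hp : IsProbVec p) (hg : IsProbVec g)
    (hpos : ∀ a, 0 < g a) : shannon p ≤ expect p fun a => -Real.log (g a) := by
  have h : ∑ a, (Real.negMulLog (p a) + p a * Real.log (g a)) ≤ ∑ a, (g a - p a) :=
    Finset.sum_le_sum fun a _ => negMulLog_add_mul_log_le (hp.nonneg a) (hpos a)
  rw [Finset.sum_add_distrib, Finset.sum_sub_distrib, hp.sum_eq_one, hg.sum_eq_one] at h
  simp only [shannon, expect, mul_neg, Finset.sum_neg_distrib]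
  linarith

/-- The case of equality in Gibbs' inequality. -/
lemma eq_of_expect_log_le_shannon {p g : α → ℝ} (hp : IsProbVec p) (hg : IsProbVec g)
    (hpos : ∀ a, 0 < g a) (h : (expect p fun a => -Real.log (g a)) ≤ shannon p) : p = g := by
  have h0 : ∑ a, (g a - p a - (Real.negMulLog (p a) + p a * Real.log (g a))) = 0 := by
    have := shannon_le_expect_log hp hg hpos
    simp only [shannon, expect, mul_neg, Finset.sum_neg_distrib] at this h
    rw [Finset.sum_sub_distrib, Finset.sum_add_distrib, Finset.sum_sub_distrib, hp.sum_eq_one,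
      hg.sum_eq_one]
    linarith
  rw [Finset.sum_eq_zero_iff_of_nonneg fun a _ =>
    sub_nonneg.2 (negMulLog_add_mul_log_le (hp.nonneg a) (hpos a))] at h0
  funext a
  exact eq_of_negMulLog_add_mul_log_eq (hp.nonneg a) (hpos a)
    (sub_eq_zero.1 (h0 a (Finset.mem_univ a))).symm

/-! ### Gibbs vectors -/

/-- The partition function of the energies `E`. -/
def partitionFn (E : α → ℝ) (β : ℝ) : ℝ := ∑ a, Real.exp (-β * E a)

/-- The Gibbs vector of the energies `E`. -/
def gibbsVec (E : α → ℝ) (β : ℝ) (a : α) : ℝ := Real.exp (-β * E a) / partitionFn E β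

/-- The uniform vector on the minimizers of `E`. -/
def groundVec (E : α → ℝ) (a : α) : ℝ :=
  open Classical in if ∀ b, E a ≤ E b then (Nat.card {i : α // ∀ j, E i ≤ E j} : ℝ)⁻¹ else 0

variable {E : α → ℝ} {β : ℝ}

lemma partitionFn_pos [Nonempty α] (E : α → ℝ) (β : ℝ) : 0 < partitionFn E β :=
  Finset.sum_pos (fun _ _ => Real.exp_pos _) Finset.univ_nonempty

lemma gibbsVec_pos [Nonempty α] (E : α → ℝ) (β : ℝ) (a : α) : 0 < gibbsVec E β a :=
  div_pos (Real.exp_pos _) (partitionFn_pos E β)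

lemma isProbVec_gibbsVec [Nonempty α] (E : α → ℝ) (β : ℝ) : IsProbVec (gibbsVec E β) where
  nonneg a := (gibbsVec_pos E β a).le
  sum_eq_one := by
    simp only [gibbsVec]
    rw [← Finset.sum_div]
    exact div_self (partitionFn_pos E β).ne'

lemma neg_log_gibbsVec [Nonempty α] (E : α → ℝ) (β : ℝ) (a : α) :
    -Real.log (gibbsVec E β a) = β * E a + Real.log (partitionFn E β) := by
  rw [gibbsVec, Real.log_div (Real.exp_pos _).ne' (partitionFn_pos E β).ne', Real.log_exp]
  ring

lemma expect_neg_log_gibbsVec [Nonempty α] {p : α → ℝ} (hp : IsProbVec p) (E : α → ℝ) (β : ℝ) :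
    (expect p fun a => -Real.log (gibbsVec E β a)) =
      β * expect p E + Real.log (partitionFn E β) := by
  simp only [neg_log_gibbsVec, expect, mul_add, Finset.sum_add_distrib, ← Finset.sum_mul,
    hp.sum_eq_one, one_mul, Finset.mul_sum]
  congr 1
  exact Finset.sum_congr rfl fun a _ => by ring

lemma shannon_gibbsVec [Nonempty α] (E : α → ℝ) (β : ℝ) :
    shannon (gibbsVec E β) = β * expect (gibbsVec E β) E + Real.log (partitionFn E β) := by
  rw [← expect_neg_log_gibbsVec (isProbVec_gibbsVec E β)]
  exact Finset.sum_congr rfl fun a _ => by rw [Real.negMulLog]; ring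

lemma shannon_le_gibbs [Nonempty α] {p : α → ℝ} (hp : IsProbVec p) (E : α → ℝ) (β : ℝ) :
    shannon p ≤ β * expect p E + Real.log (partitionFn E β) := by
  rw [← expect_neg_log_gibbsVec hp]
  exact shannon_le_expect_log hp (isProbVec_gibbsVec E β) (gibbsVec_pos E β)

/-- Under these hypotheses the upper bound `β E(p) + log Z` on the entropy of `p` is attained, which
is the equality case of Gibbs' inequality. At β = 0 the energy drops out of the bound, so no
comparison of energies is needed. -/
lemma eq_gibbsVec [Nonempty α] {p : α → ℝ} (hp : IsProbVec p) (hβ : 0 ≤ β)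
    (hS : shannon p = shannon (gibbsVec E β))
    (hE : β = 0 ∨ expect p E ≤ expect (gibbsVec E β) E) : p = gibbsVec E β := by
  refine eq_of_expect_log_le_shannon hp (isProbVec_gibbsVec E β) (gibbsVec_pos E β) ?_
  rw [expect_neg_log_gibbsVec hp, hS, shannon_gibbsVec]
  rcases hE with rfl | hE
  · simp
  · gcongr

/-- The Gibbs vector attains the bound `S ≤ β E + log Z`, so less energy would mean less entropy.
Cancelling β needs it to be positive. -/
lemma expect_le_expect_gibbsVec [Nonempty α] {p : α → ℝ} (hp : IsProbVec p) (hβ : 0 < β)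
    (hS : shannon (gibbsVec E β) ≤ shannon p) : expect (gibbsVec E β) E ≤ expect p E := by
  have := shannon_le_gibbs hp E β
  rw [shannon_gibbsVec] at hS
  exact le_of_mul_le_mul_left (by linarith) hβ

lemma partitionFn_zero (E : α → ℝ) : partitionFn E 0 = Fintype.card α := by
  simp [partitionFn]

lemma gibbsVec_zero (E : α → ℝ) : gibbsVec E 0 = fun _ => (Fintype.card α : ℝ)⁻¹ := by
  funext a
  simp [gibbsVec, partitionFn_zero]

lemma shannon_le_log_card [Nonempty α] {p : α → ℝ} (hp : IsProbVec p) :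
    shannon p ≤ Real.log (Fintype.card α) := by
  simpa [partitionFn_zero] using shannon_le_gibbs hp 0 0

lemma shannon_uniform [Nonempty α] :
    shannon (fun _ : α => (Fintype.card α : ℝ)⁻¹) = Real.log (Fintype.card α) := by
  simpa [partitionFn_zero, gibbsVec_zero] using shannon_gibbsVec (0 : α → ℝ) 0

lemma isProbVec_uniform [Nonempty α] : IsProbVec (fun _ : α => (Fintype.card α : ℝ)⁻¹) :=
  gibbsVec_zero (0 : α → ℝ) ▸ isProbVec_gibbsVec _ 0

lemma eq_uniform_of_shannon_eq [Nonempty α] {p : α → ℝ} (hp : IsProbVec p)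
    (h : shannon p = Real.log (Fintype.card α)) : p = fun _ => (Fintype.card α : ℝ)⁻¹ := by
  rw [← gibbsVec_zero (0 : α → ℝ)]
  exact eq_gibbsVec hp le_rfl (by rw [h, gibbsVec_zero, shannon_uniform]) (Or.inl rfl)

lemma continuous_shannon : Continuous (shannon : (α → ℝ) → ℝ) := by
  unfold shannon
  exact continuous_finsetSum _ fun a _ => Real.continuous_negMulLog.comp (continuous_apply a)

lemma continuous_gibbsVec [Nonempty α] (E : α → ℝ) : Continuous (gibbsVec E) := by
  refine continuous_pi fun a => ?_
  unfold gibbsVec partitionFn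
  exact Continuous.div (by fun_prop) (by fun_prop) fun β => (partitionFn_pos E β).ne'

lemma exists_isMin [Nonempty α] (E : α → ℝ) : ∃ a, ∀ b, E a ≤ E b := by
  obtain ⟨a, -, ha⟩ := Finset.exists_min_image Finset.univ E Finset.univ_nonempty
  exact ⟨a, fun b => ha b (Finset.mem_univ b)⟩

lemma card_ground_pos [Nonempty α] (E : α → ℝ) : 0 < Nat.card {i : α // ∀ j, E i ≤ E j} := by
  obtain ⟨a, ha⟩ := exists_isMin E
  have : Nonempty {i : α // ∀ j, E i ≤ E j} := ⟨⟨a, ha⟩⟩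
  exact Nat.card_pos

lemma tendsto_gibbsVec [Nonempty α] (E : α → ℝ) :
    Tendsto (gibbsVec E) atTop (𝓝 (groundVec E)) := by
  classical
  obtain ⟨a₀, h₀⟩ := exists_isMin E
  have hexp : ∀ a, Tendsto (fun β : ℝ => Real.exp (-β * (E a - E a₀))) atTop
      (𝓝 (if ∀ b, E a ≤ E b then 1 else 0)) := by
    intro a
    split_ifs with h
    · have : E a - E a₀ = 0 := sub_eq_zero.2 (le_antisymm (h a₀) (h₀ a))
      simp [this]
    · have hpos : 0 < E a - E a₀ := by
        push Not at h
        obtain ⟨b, hb⟩ := h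
        linarith [h₀ b]
      refine Real.tendsto_exp_atBot.comp ?_
      exact (tendsto_neg_atTop_atBot).atBot_mul_const hpos
  -- Measuring energies from the minimum makes each exponential tend to 1 or 0, and the denominator
  -- to the ground degeneracy, which is nonzero.
  have heq : ∀ β a, gibbsVec E β a =
      Real.exp (-β * (E a - E a₀)) / ∑ b, Real.exp (-β * (E b - E a₀)) := by
    intro β a
    have h (b : α) : Real.exp (-β * (E b - E a₀)) = Real.exp (-β * E b) * Real.exp (β * E a₀) := by
      rw [← Real.exp_add]; ring_nf
    simp only [h, ← Finset.sum_mul]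
    rw [mul_div_mul_right _ _ (Real.exp_pos _).ne']
    rfl
  have hsum : (∑ b : α, if ∀ c, E b ≤ E c then (1 : ℝ) else 0) =
      Nat.card {i : α // ∀ j, E i ≤ E j} := by
    rw [Finset.sum_boole, Nat.card_eq_fintype_card, Fintype.card_subtype]
  refine tendsto_pi_nhds.2 fun a => ?_
  simp only [heq]
  have h := (hexp a).div (tendsto_finsetSum Finset.univ fun b _ => hexp b)
    (by rw [hsum]; exact_mod_cast (card_ground_pos E).ne')
  rw [hsum] at h
  have hg : groundVec E a = (if ∀ b, E a ≤ E b then 1 else 0) /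
      (Nat.card {i : α // ∀ j, E i ≤ E j} : ℝ) := by
    simp only [groundVec]
    split_ifs <;> simp
  rw [hg]
  exact h

lemma isProbVec_groundVec [Nonempty α] (E : α → ℝ) : IsProbVec (groundVec E) where
  nonneg a := ge_of_tendsto (tendsto_pi_nhds.1 (tendsto_gibbsVec E) a)
    (Eventually.of_forall fun β => (gibbsVec_pos E β a).le)
  sum_eq_one := by
    refine tendsto_nhds_unique (tendsto_finsetSum Finset.univ fun a _ =>
      tendsto_pi_nhds.1 (tendsto_gibbsVec E) a) ?_
    exact tendsto_const_nhds.congr fun β => (isProbVec_gibbsVec E β).sum_eq_one.symm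

lemma shannon_groundVec [Nonempty α] (E : α → ℝ) :
    shannon (groundVec E) = Real.log (Nat.card {i : α // ∀ j, E i ≤ E j}) := by
  classical
  have hc : (Nat.card {i : α // ∀ j, E i ≤ E j} : ℝ) ≠ 0 := by
    exact_mod_cast (card_ground_pos E).ne'
  have h : ∀ a, Real.negMulLog (groundVec E a) =
      groundVec E a * Real.log (Nat.card {i : α // ∀ j, E i ≤ E j}) := by
    intro a
    simp only [groundVec]
    split_ifs <;> simp [Real.negMulLog]
  simp only [shannon, h, ← Finset.sum_mul, (isProbVec_groundVec E).sum_eq_one, one_mul]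

lemma expect_groundVec_le [Nonempty α] (E : α → ℝ) (a : α) : expect (groundVec E) E ≤ E a := by
  have h : ∀ b, groundVec E b * E b ≤ groundVec E b * E a := by
    intro b
    by_cases hb : ∀ c, E b ≤ E c
    · exact mul_le_mul_of_nonneg_left (hb a) ((isProbVec_groundVec E).nonneg b)
    · simp [groundVec, hb]
  calc expect (groundVec E) E ≤ ∑ b, groundVec E b * E a := Finset.sum_le_sum fun b _ => h b
    _ = E a := by rw [← Finset.sum_mul, (isProbVec_groundVec E).sum_eq_one, one_mul]

lemma expect_groundVec_le_expect [Nonempty α] {p : α → ℝ} (hp : IsProbVec p) (E : α → ℝ) :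
    expect (groundVec E) E ≤ expect p E :=
  calc expect (groundVec E) E = ∑ a, p a * expect (groundVec E) E := by
        rw [← Finset.sum_mul, hp.sum_eq_one, one_mul]
    _ ≤ expect p E := Finset.sum_le_sum fun a _ =>
        mul_le_mul_of_nonneg_left (expect_groundVec_le E a) (hp.nonneg a)

/-- The thermal vectors of the energies `E`. -/
def IsThermalVec (E s : α → ℝ) : Prop := (∃ β : ℝ, 0 ≤ β ∧ s = gibbsVec E β) ∨ s = groundVec E

lemma IsThermalVec.isProbVec [Nonempty α] {s : α → ℝ} (hs : IsThermalVec E s) : IsProbVec s := by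
  rcases hs with ⟨β, -, rfl⟩ | rfl
  · exact isProbVec_gibbsVec E β
  · exact isProbVec_groundVec E

/-- No monotonicity of the entropy in β is used: each thermal vector with β > 0 has minimal energy
at its entropy, so `eq_gibbsVec` applies. The claim is about vectors, not β, since a constant `E`
gives the same vector at every β. -/
lemma IsThermalVec.eq_of_shannon_eq [Nonempty α] {s t : α → ℝ} (hs : IsThermalVec E s)
    (ht : IsThermalVec E t) (h : shannon s = shannon t) : s = t := by
  have aux : ∀ {β : ℝ} {t : α → ℝ}, 0 ≤ β → t = groundVec E →
      shannon t = shannon (gibbsVec E β) → t = gibbsVec E β := by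
    rintro β t hβ rfl h
    exact eq_gibbsVec (isProbVec_groundVec E) hβ h
      (Or.inr (expect_groundVec_le_expect (isProbVec_gibbsVec E β) E))
  rcases hs with ⟨β, hβ, rfl⟩ | hs <;> rcases ht with ⟨γ, hγ, rfl⟩ | ht
  · rcases hγ.eq_or_lt with rfl | hγ'
    · exact eq_gibbsVec (isProbVec_gibbsVec E β) hγ h (Or.inl rfl)
    rcases hβ.eq_or_lt with rfl | hβ'
    · exact (eq_gibbsVec (isProbVec_gibbsVec E γ) hβ h.symm (Or.inl rfl)).symm
    exact eq_gibbsVec (isProbVec_gibbsVec E β) hγ h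
      (Or.inr (expect_le_expect_gibbsVec (isProbVec_gibbsVec E γ) hβ' h.le))
  · exact (aux hβ ht h.symm).symm
  · exact aux hγ hs h
  · rw [hs, ht]

lemma exists_isThermalVec [Nonempty α] (E : α → ℝ) {S : ℝ} (h1 : shannon (groundVec E) ≤ S)
    (h2 : S ≤ Real.log (Fintype.card α)) : ∃ s, IsThermalVec E s ∧ shannon s = S := by
  -- The entropy of the ground vector may be only a limit as β → ∞, so this endpoint is taken from
  -- the ground vector itself; above it, a finite β suffices.
  rcases h1.eq_or_lt with h1 | h1
  · exact ⟨_, Or.inr rfl, h1⟩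
  have hlim : Tendsto (fun β => shannon (gibbsVec E β)) atTop (𝓝 (shannon (groundVec E))) :=
    (continuous_shannon.tendsto _).comp (tendsto_gibbsVec E)
  obtain ⟨β, hlt, hβ⟩ := ((hlim.eventually_lt_const h1).and (eventually_ge_atTop 0)).exists
  have hcont : ContinuousOn (fun β => shannon (gibbsVec E β)) (Set.Icc 0 β) :=
    (continuous_shannon.comp (continuous_gibbsVec E)).continuousOn
  obtain ⟨γ, hγ, hS⟩ := intermediate_value_Icc' hβ hcont
    ⟨hlt.le, by simpa [gibbsVec_zero, shannon_uniform] using h2⟩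
  exact ⟨_, Or.inl ⟨γ, hγ.1, rfl⟩, hS⟩

end Classical

/-! ### Product vectors and typical sequences -/

section Product

variable {α : Type*}

/-- The product vector `p ⊗ ⋯ ⊗ p`. -/
def powVec (p : α → ℝ) (N : ℕ) (x : Fin N → α) : ℝ := ∏ k, p (x k)

/-- The sum of `f` along a sequence. -/
def sumFn (f : α → ℝ) (N : ℕ) (x : Fin N → α) : ℝ := ∑ k, f (x k)

lemma powVec_cons (p : α → ℝ) (N : ℕ) (a : α) (y : Fin N → α) :
    powVec p (N + 1) (Fin.cons a y) = p a * powVec p N y := by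
  simp [powVec, Fin.prod_univ_succ]

lemma sumFn_cons (f : α → ℝ) (N : ℕ) (a : α) (y : Fin N → α) :
    sumFn f (N + 1) (Fin.cons a y) = f a + sumFn f N y := by
  simp [sumFn, Fin.sum_univ_succ]

/-- The weight of a sequence is governed by a sum of independent terms `-log p`, to which
Chebyshev's inequality applies. Positivity is needed because `Real.log 0 = 0`. -/
lemma powVec_eq_exp {p : α → ℝ} {N : ℕ} {x : Fin N → α} (hx : ∀ k, 0 < p (x k)) :
    powVec p N x = Real.exp (-sumFn (fun a => -Real.log (p a)) N x) := by
  simp only [sumFn, Finset.sum_neg_distrib, neg_neg, Real.exp_sum, powVec]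
  exact Finset.prod_congr rfl fun k _ => (Real.exp_log (hx k)).symm

variable [Fintype α]

lemma sum_fin_succ (N : ℕ) (F : (Fin (N + 1) → α) → ℝ) :
    ∑ x, F x = ∑ a, ∑ y : Fin N → α, F (Fin.cons a y) := by
  rw [← (Fin.consEquiv fun _ => α).sum_comp, Fintype.sum_prod_type]
  rfl

lemma IsProbVec.powVec {p : α → ℝ} (hp : IsProbVec p) (N : ℕ) : IsProbVec (powVec p N) where
  nonneg x := Finset.prod_nonneg fun k _ => hp.nonneg (x k)
  sum_eq_one := by
    induction N with
    | zero => simp [ObsErgo.powVec]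
    | succ N ih =>
      simp_rw [sum_fin_succ, powVec_cons, ← Finset.mul_sum, ih, mul_one, hp.sum_eq_one]

lemma shannon_powVec {p : α → ℝ} (hp : IsProbVec p) (N : ℕ) :
    shannon (powVec p N) = N * shannon p := by
  induction N with
  | zero => simp [shannon, powVec]
  | succ N ih =>
    unfold shannon at ih ⊢
    simp_rw [sum_fin_succ, powVec_cons, Real.negMulLog_mul, Finset.sum_add_distrib,
      ← Finset.sum_mul, ← Finset.mul_sum, (hp.powVec N).sum_eq_one, one_mul, ih, ← Finset.sum_mul,
      hp.sum_eq_one]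
    push_cast
    ring

lemma expect_powVec_sumFn {p : α → ℝ} (hp : IsProbVec p) (f : α → ℝ) (N : ℕ) :
    expect (powVec p N) (sumFn f N) = N * expect p f := by
  induction N with
  | zero => simp [expect, sumFn]
  | succ N ih =>
    unfold expect at ih ⊢
    have h : ∀ a (y : Fin N → α), p a * powVec p N y * (f a + sumFn f N y) =
        p a * f a * powVec p N y + p a * (powVec p N y * sumFn f N y) := fun a y => by ring
    simp_rw [sum_fin_succ, powVec_cons, sumFn_cons, h, Finset.sum_add_distrib, ← Finset.mul_sum,
      (hp.powVec N).sum_eq_one, ih, ← Finset.sum_mul, hp.sum_eq_one]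
    push_cast
    ring

lemma partitionFn_sumFn (E : α → ℝ) (β : ℝ) (N : ℕ) :
    partitionFn (sumFn E N) β = partitionFn E β ^ N := by
  induction N with
  | zero => simp [partitionFn, sumFn]
  | succ N ih =>
    unfold partitionFn at ih ⊢
    simp_rw [sum_fin_succ, sumFn_cons, mul_add, Real.exp_add, ← Finset.mul_sum, ih,
      ← Finset.sum_mul]
    ring

/-- Independence and centering kill the cross terms, so variances add. -/
lemma expect_powVec_sumFn_sq {p : α → ℝ} (hp : IsProbVec p) {f : α → ℝ} (hf : expect p f = 0)
    (N : ℕ) :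
    (expect (powVec p N) fun x => sumFn f N x ^ 2) = N * expect p fun a => f a ^ 2 := by
  induction N with
  | zero => simp [expect, sumFn]
  | succ N ih =>
    have h0 := expect_powVec_sumFn hp f N
    unfold expect at ih hf h0 ⊢
    have h : ∀ a (y : Fin N → α), p a * powVec p N y * (f a + sumFn f N y) ^ 2 =
        p a * f a ^ 2 * powVec p N y + 2 * (p a * f a) * (powVec p N y * sumFn f N y) +
          p a * (powVec p N y * sumFn f N y ^ 2) := fun a y => by ring
    simp_rw [sum_fin_succ, powVec_cons, sumFn_cons, h, Finset.sum_add_distrib, ← Finset.mul_sum,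
      (hp.powVec N).sum_eq_one, ih, h0, hf, ← Finset.sum_mul, hp.sum_eq_one]
    push_cast
    ring

/-- Chebyshev's inequality for the sum of `f` along a random sequence. -/
lemma sum_powVec_filter_le {p : α → ℝ} (hp : IsProbVec p) (f : α → ℝ) {δ : ℝ} (hδ : 0 < δ) :
    ∃ C : ℝ, 0 ≤ C ∧ ∀ N : ℕ, 0 < N →
      ∑ x with N * δ < |sumFn f N x - N * expect p f|, powVec p N x ≤ C / N := by
  set m := expect p f with hm
  have h0 : expect p (fun a => f a - m) = 0 := by
    simp only [expect, mul_sub, Finset.sum_sub_distrib, ← Finset.sum_mul, hp.sum_eq_one] at hm ⊢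
    rw [hm]; ring
  set V := expect p fun a => (f a - m) ^ 2
  have hV : 0 ≤ V := Finset.sum_nonneg fun a _ => mul_nonneg (hp.nonneg a) (sq_nonneg _)
  refine ⟨V / δ ^ 2, by positivity, fun N hN => ?_⟩
  have hN' : (0 : ℝ) < N := by exact_mod_cast hN
  have hs : ∀ x : Fin N → α, sumFn (fun a => f a - m) N x = sumFn f N x - N * m := by
    intro x
    simp [sumFn]
  have h1 : ∑ x with N * δ < |sumFn f N x - N * m|, powVec p N x * (N * δ) ^ 2 ≤ N * V := by
    rw [← expect_powVec_sumFn_sq hp h0 N, expect]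
    refine (Finset.sum_le_sum (g := fun x => powVec p N x * sumFn (fun a => f a - m) N x ^ 2)
      fun x hx => ?_).trans (Finset.sum_le_sum_of_subset_of_nonneg (Finset.filter_subset _ _)
        fun x _ _ => mul_nonneg ((hp.powVec N).nonneg x) (sq_nonneg _))
    rw [Finset.mem_filter] at hx
    rw [hs, ← sq_abs (sumFn f N x - N * m)]
    exact mul_le_mul_of_nonneg_left (pow_le_pow_left₀ (by positivity) hx.2.le 2)
      ((hp.powVec N).nonneg x)
  rw [← Finset.sum_mul] at h1
  rw [div_div, le_div_iff₀ (by positivity)]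
  refine le_of_mul_le_mul_right ?_ hN'
  calc _ = (∑ x with N * δ < |sumFn f N x - N * m|, powVec p N x) * (N * δ) ^ 2 := by ring
    _ ≤ N * V := h1
    _ = V * N := mul_comm _ _

lemma expect_neg_log_self (p : α → ℝ) : (expect p fun a => -Real.log (p a)) = shannon p :=
  Finset.sum_congr rfl fun a _ => by rw [Real.negMulLog]; ring

/-- Almost all of the weight of `p ⊗ ⋯ ⊗ p` lies on at most `exp (N (S(p) + δ))` sequences. -/
lemma exists_small_typical {p : α → ℝ} (hp : IsProbVec p) {δ : ℝ} (hδ : 0 < δ) :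
    ∃ C : ℝ, 0 ≤ C ∧ ∀ N : ℕ, 0 < N → ∃ A : Finset (Fin N → α),
      (A.card : ℝ) ≤ Real.exp (N * (shannon p + δ)) ∧ 1 - C / N ≤ ∑ x ∈ A, powVec p N x := by
  classical
  obtain ⟨C, hC, h⟩ := sum_powVec_filter_le hp (fun a => -Real.log (p a)) hδ
  refine ⟨C, hC, fun N hN => ?_⟩
  specialize h N hN
  rw [expect_neg_log_self] at h
  set f : α → ℝ := fun a => -Real.log (p a)
  -- Positivity of every letter is imposed separately: with `Real.log 0 = 0` a sequence of weight
  -- zero could pass the deviation test and spoil the count.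
  let A : Finset (Fin N → α) := {x | (∀ k, 0 < p (x k)) ∧ |sumFn f N x - N * shannon p| ≤ N * δ}
  refine ⟨A, ?_, ?_⟩
  -- Every member of `A` weighs at least this exponential, and the total weight is at most 1.
  · have h1 : ∑ x ∈ A, Real.exp (-(N * (shannon p + δ))) ≤ 1 := by
      rw [← (hp.powVec N).sum_eq_one]
      refine (Finset.sum_le_sum (g := powVec p N) fun x hx => ?_).trans
        (Finset.sum_le_sum_of_subset_of_nonneg (Finset.subset_univ _)
          fun x _ _ => (hp.powVec N).nonneg x)
      rw [Finset.mem_filter] at hx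
      rw [powVec_eq_exp hx.2.1]
      have := (abs_le.1 hx.2.2).2
      exact Real.exp_le_exp.2 (by simp only [f] at this; linarith)
    rw [Finset.sum_const, nsmul_eq_mul, Real.exp_neg] at h1
    rwa [← div_eq_mul_inv, div_le_one (Real.exp_pos _)] at h1
  · have h2 : ∑ x ∈ Aᶜ, powVec p N x ≤ ∑ x with N * δ < |sumFn f N x - N * shannon p|,
        powVec p N x := by
      rw [← Finset.sum_filter_ne_zero (s := Aᶜ)]
      refine Finset.sum_le_sum_of_subset_of_nonneg (fun x hx => ?_)
        fun x _ _ => (hp.powVec N).nonneg x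
      rw [Finset.mem_filter, Finset.mem_compl, Finset.mem_filter] at hx
      rw [Finset.mem_filter]
      refine ⟨Finset.mem_univ x, ?_⟩
      by_contra hlt
      refine hx.1 ⟨Finset.mem_univ x, fun k => ?_, not_lt.1 hlt⟩
      exact lt_of_le_of_ne (hp.nonneg _) fun h0 =>
        hx.2 (Finset.prod_eq_zero (Finset.mem_univ k) h0.symm)
    have h3 := Finset.sum_add_sum_compl A (powVec p N)
    rw [(hp.powVec N).sum_eq_one] at h3
    linarith

/-- At least `exp (N (S(q) - δ)) / 2` sequences have mean energy at most `E(q) + ε`. -/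
lemma exists_large_lowEnergy {q : α → ℝ} (hq : IsProbVec q) (hpos : ∀ a, 0 < q a) (E : α → ℝ)
    {δ ε : ℝ} (hδ : 0 < δ) (hε : 0 < ε) :
    ∀ᶠ N : ℕ in atTop, ∃ B : Finset (Fin N → α),
      Real.exp (N * (shannon q - δ)) / 2 ≤ B.card ∧
        ∀ y ∈ B, sumFn E N y ≤ N * (expect q E + ε) := by
  classical
  obtain ⟨C, hC, h⟩ := sum_powVec_filter_le hq (fun a => -Real.log (q a)) hδ
  obtain ⟨D, hD, h'⟩ := sum_powVec_filter_le hq E hε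
  -- This threshold makes the two exceptional sets weigh at most `(C + D) / N ≤ 1 / 2` together,
  -- leaving weight at least 1/2 for the set being counted.
  filter_upwards [eventually_gt_atTop 0, eventually_ge_atTop ⌈2 * (C + D)⌉₊] with N hN hCD
  specialize h N hN
  specialize h' N hN
  have hN' : (0 : ℝ) < N := by exact_mod_cast hN
  rw [expect_neg_log_self] at h
  set f : α → ℝ := fun a => -Real.log (q a)
  set F₁ : Finset (Fin N → α) := {x | N * δ < |sumFn f N x - N * shannon q|}
  set F₂ : Finset (Fin N → α) := {x | N * ε < |sumFn E N x - N * expect q E|}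
  have hnn : ∀ x, 0 ≤ powVec q N x := (hq.powVec N).nonneg
  refine ⟨(F₁ ∪ F₂)ᶜ, ?_, fun y hy => ?_⟩
  · have h1 : ∑ x ∈ F₁ ∪ F₂, powVec q N x ≤ 1 / 2 := by
      refine (Finset.sum_union_inter (s₁ := F₁) (s₂ := F₂) (f := powVec q N) ▸
        le_add_of_nonneg_right (Finset.sum_nonneg fun x _ => hnn x)).trans ((add_le_add h h').trans ?_)
      rw [← add_div, div_le_iff₀ hN']
      have := (Nat.le_ceil _).trans (Nat.cast_le (α := ℝ).2 hCD)
      linarith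
    have h2 := Finset.sum_add_sum_compl (F₁ ∪ F₂) (powVec q N)
    rw [(hq.powVec N).sum_eq_one] at h2
    have h3 : ∑ x ∈ (F₁ ∪ F₂)ᶜ, powVec q N x ≤
        ∑ x ∈ (F₁ ∪ F₂)ᶜ, Real.exp (-(N * (shannon q - δ))) := by
      refine Finset.sum_le_sum fun x hx => ?_
      rw [Finset.mem_compl, Finset.mem_union, not_or] at hx
      have hx1 := hx.1
      simp only [F₁, Finset.mem_filter, Finset.mem_univ, true_and, not_lt] at hx1
      rw [powVec_eq_exp fun k => hpos _]
      have := (abs_le.1 hx1).1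
      exact Real.exp_le_exp.2 (by simp only [f] at this; linarith)
    rw [Finset.sum_const, nsmul_eq_mul, Real.exp_neg, ← div_eq_mul_inv] at h3
    have h4 : 1 / 2 ≤ ((F₁ ∪ F₂)ᶜ.card : ℝ) / Real.exp (N * (shannon q - δ)) := by linarith
    rw [le_div_iff₀ (Real.exp_pos _)] at h4
    linarith
  · rw [Finset.mem_compl, Finset.mem_union, not_or] at hy
    have hy2 := hy.2
    simp only [F₂, Finset.mem_filter, Finset.mem_univ, true_and, not_lt] at hy2
    have := (abs_le.1 hy2).2
    linarith

/-- A bijection from `A` onto a subset of `B` extends to the whole finite type, since the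
complements have equal cardinality. -/
lemma exists_perm_mapsTo {β : Type*} [Fintype β] {A B : Finset β} (h : A.card ≤ B.card) :
    ∃ π : Equiv.Perm β, ∀ x ∈ A, π x ∈ B := by
  classical
  obtain ⟨B', hB', hc⟩ := Finset.exists_subset_card_eq h
  let e : {x // x ∈ A} ≃ {x // x ∈ B'} := Finset.equivOfCardEq hc.symm
  exact ⟨e.extendSubtype, fun x hx => hB' (e.extendSubtype_mem x hx)⟩

/-- If `q` has more entropy than `p`, then a permutation of the sequences takes `p ⊗ ⋯ ⊗ p` to a
vector whose mean energy per place hardly exceeds that of `q`. -/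
lemma exists_perm_energy_le {p q : α → ℝ} (hp : IsProbVec p) (hq : IsProbVec q)
    (hpos : ∀ a, 0 < q a) (hS : shannon p < shannon q) (E : α → ℝ) {ε : ℝ} (hε : 0 < ε) :
    ∀ᶠ N : ℕ in atTop, ∃ π : Equiv.Perm (Fin N → α),
      ∑ x, powVec p N x * sumFn E N (π x) ≤ N * (expect q E + ε) := by
  -- One third goes to each typicality tolerance; the remaining factor `exp (N δ)` absorbs the 1/2
  -- in the count for `q`.
  set δ := (shannon q - shannon p) / 3 with hδ
  have hδ0 : 0 < δ := by rw [hδ]; linarith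
  obtain ⟨C, hC, hA⟩ := exists_small_typical hp hδ0
  set M := ∑ a, |E a| + |expect q E| with hM
  have hM0 : 0 ≤ M := by positivity
  have hEM : ∀ a, E a ≤ expect q E + M := by
    intro a
    have h1 := Finset.single_le_sum (f := fun a => |E a|) (fun b _ => abs_nonneg _)
      (Finset.mem_univ a)
    have h2 := neg_abs_le (expect q E)
    have h3 := le_abs_self (E a)
    linarith
  have hexp : ∀ᶠ N : ℕ in atTop, 2 ≤ Real.exp (N * δ) :=
    (Real.tendsto_exp_atTop.comp
      (tendsto_natCast_atTop_atTop.atTop_mul_const hδ0)).eventually_ge_atTop 2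
  -- Atypical sequences have weight at most `C / N` and exceed the target energy by at most `M` per
  -- place.
  have hCM : ∀ᶠ N : ℕ in atTop, C / N * M ≤ ε / 2 := by
    have : Tendsto (fun N : ℕ => C / N * M) atTop (𝓝 (0 * M)) :=
      (tendsto_const_div_atTop_nhds_zero_nat C).mul_const M
    rw [zero_mul] at this
    exact this.eventually_le_const (by positivity)
  filter_upwards [exists_large_lowEnergy hq hpos E hδ0 (half_pos hε), eventually_gt_atTop 0,
    hexp, hCM] with N hB hN h2 hCM
  classical
  obtain ⟨A, hAcard, hAsum⟩ := hA N hN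
  obtain ⟨B, hBcard, hBE⟩ := hB
  have hN' : (0 : ℝ) < N := by exact_mod_cast hN
  have hcard : A.card ≤ B.card := by
    have : (A.card : ℝ) ≤ B.card := by
      refine hAcard.trans (le_trans ?_ hBcard)
      have : (N : ℝ) * (shannon q - δ) = N * (shannon p + δ) + N * δ := by rw [hδ]; ring
      rw [this, Real.exp_add]
      have := mul_le_mul_of_nonneg_left h2 (Real.exp_pos (N * (shannon p + δ))).le
      linarith
    exact_mod_cast this
  obtain ⟨π, hπ⟩ := exists_perm_mapsTo hcard
  refine ⟨π, ?_⟩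
  have hnn : ∀ x, 0 ≤ powVec p N x := (hp.powVec N).nonneg
  have h1 : ∑ x ∈ A, powVec p N x * sumFn E N (π x) ≤
      ∑ x ∈ A, powVec p N x * (N * (expect q E + ε / 2)) :=
    Finset.sum_le_sum fun x hx => mul_le_mul_of_nonneg_left (hBE _ (hπ x hx)) (hnn x)
  have h3 : ∑ x ∈ Aᶜ, powVec p N x * sumFn E N (π x) ≤
      ∑ x ∈ Aᶜ, powVec p N x * (N * (expect q E + M)) := by
    refine Finset.sum_le_sum fun x hx => mul_le_mul_of_nonneg_left ?_ (hnn x)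
    refine (Finset.sum_le_sum fun k _ => hEM (π x k)).trans ?_
    rw [Finset.sum_const, Finset.card_univ, Fintype.card_fin, nsmul_eq_mul]
  have h4 := Finset.sum_add_sum_compl A (powVec p N)
  rw [(hp.powVec N).sum_eq_one] at h4
  rw [← Finset.sum_mul] at h1 h3
  rw [← Finset.sum_add_sum_compl A]
  set s := ∑ x ∈ A, powVec p N x
  set t := ∑ x ∈ Aᶜ, powVec p N x with ht
  have ht0 : 0 ≤ t := Finset.sum_nonneg fun x _ => hnn x
  have hs : s = 1 - t := by linarith
  have htC : t * M ≤ ε / 2 := (mul_le_mul_of_nonneg_right (by linarith) hM0).trans hCM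
  calc _ ≤ s * (N * (expect q E + ε / 2)) + t * (N * (expect q E + M)) := add_le_add h1 h3
    _ = N * (expect q E + ε / 2 + t * M - t * (ε / 2)) := by rw [hs]; ring
    _ ≤ N * (expect q E + ε) := by
      refine mul_le_mul_of_nonneg_left ?_ hN'.le
      have := mul_nonneg ht0 (half_pos hε).le
      linarith

/-- A vector whose entropy is not maximal is a limit, in energy, of positive vectors of larger
entropy. -/
lemma exists_shannon_lt [Nonempty α] {s : α → ℝ} (hs : IsProbVec s)
    (hS : shannon s < Real.log (Fintype.card α)) (E : α → ℝ) {ε : ℝ} (hε : 0 < ε) :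
    ∃ q, IsProbVec q ∧ (∀ a, 0 < q a) ∧ shannon s < shannon q ∧ expect q E ≤ expect s E + ε := by
  set u : α → ℝ := fun _ => (Fintype.card α : ℝ)⁻¹ with hu
  have huP : IsProbVec u := isProbVec_uniform
  have hu0 : 0 < (Fintype.card α : ℝ)⁻¹ := inv_pos.2 (by exact_mod_cast Fintype.card_pos)
  set D := |expect u E - expect s E| with hD
  have hD0 : 0 ≤ D := abs_nonneg _
  -- Mixing in the uniform vector with weight `t` raises the entropy by concavity and makes all
  -- entries positive; this `t` keeps the change of energy, at most `t * D`, below ε.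
  set t : ℝ := ε / (ε + D) with ht
  have ht0 : 0 < t := by positivity
  have ht1 : t ≤ 1 := by rw [ht, div_le_one (by positivity)]; linarith
  have htD : t * D ≤ ε := by
    rw [ht, div_mul_eq_mul_div, div_le_iff₀ (by positivity)]
    nlinarith
  refine ⟨fun a => (1 - t) * s a + t * u a, ⟨fun a => ?_, ?_⟩, fun a => ?_, ?_, ?_⟩
  · exact add_nonneg (mul_nonneg (by linarith) (hs.nonneg a)) (mul_nonneg ht0.le hu0.le)
  · simp only [Finset.sum_add_distrib, ← Finset.mul_sum, hs.sum_eq_one, huP.sum_eq_one]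
    ring
  · exact add_pos_of_nonneg_of_pos (mul_nonneg (by linarith) (hs.nonneg a)) (mul_pos ht0 hu0)
  · have h : (1 - t) * shannon s + t * shannon u ≤ shannon fun a => (1 - t) * s a + t * u a := by
      simp only [shannon, Finset.mul_sum, ← Finset.sum_add_distrib]
      exact Finset.sum_le_sum fun a _ => Real.concaveOn_negMulLog.2 (hs.nonneg a) (huP.nonneg a)
        (by linarith) ht0.le (by ring)
    rw [hu, shannon_uniform] at h
    have := mul_pos ht0 (sub_pos.2 hS)
    refine lt_of_lt_of_le ?_ h
    linarith
  · have h : (expect (fun a => (1 - t) * s a + t * u a) E) =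
        expect s E + t * (expect u E - expect s E) := by
      simp only [expect, add_mul, Finset.sum_add_distrib, mul_assoc, ← Finset.mul_sum]
      ring
    rw [h]
    have := mul_le_mul_of_nonneg_left (le_abs_self (expect u E - expect s E)) ht0.le
    linarith

end Product

/-! ### Functional calculus of orthogonal idempotents -/

section Idempotents

variable {d ι : Type*} [Fintype d] [DecidableEq d] [Fintype ι]

/-- Orthogonality makes products of such combinations coefficientwise, and completeness lets
constants be written in the same form. -/
lemma aeval_sum_smul_idempotents {e : ι → Matrix d d ℂ} (he : CompleteOrthogonalIdempotents e)
    (c : ι → ℝ) (q : Polynomial ℝ) :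
    Polynomial.aeval (∑ i, (c i : ℂ) • e i) q = ∑ i, ((q.eval (c i) : ℝ) : ℂ) • e i := by
  classical
  have hC : ∀ a : ℝ, algebraMap ℝ (Matrix d d ℂ) a = ∑ i, (a : ℂ) • e i := fun a => by
    rw [← Finset.smul_sum, he.complete, Algebra.algebraMap_eq_smul_one]
    ext i j
    simp [Matrix.smul_apply]
  have hmul : ∀ f g : ι → ℂ, (∑ i, f i • e i) * ∑ i, g i • e i = ∑ i, (f i * g i) • e i := by
    intro f g
    simp_rw [Finset.sum_mul, Finset.mul_sum, smul_mul_smul_comm, he.mul_eq]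
    exact Finset.sum_congr rfl fun i _ => by simp
  induction q using Polynomial.induction_on with
  | C a => simp [hC]
  | add p q hp hq =>
    simp only [map_add, hp, hq, Polynomial.eval_add, Complex.ofReal_add, add_smul,
      Finset.sum_add_distrib]
  | monomial n a ih =>
    rw [pow_succ, ← mul_assoc, map_mul, ih, Polynomial.aeval_X, hmul]
    exact Finset.sum_congr rfl fun i _ => by simp

/-- The functional calculus acts on the coefficients of a combination of orthogonal projectors. -/
lemma cfc_sum_smul_idempotents {e : ι → Matrix d d ℂ} (he : CompleteOrthogonalIdempotents e)
    (hh : ∀ i, (e i).IsHermitian) (c : ι → ℝ) (f : ℝ → ℝ) :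
    cfc f (∑ i, (c i : ℂ) • e i) = ∑ i, ((f (c i) : ℝ) : ℂ) • e i := by
  classical
  set A := ∑ i, (c i : ℂ) • e i with hA
  have hAh : IsSelfAdjoint A := by
    exact isSelfAdjoint_sum _ fun i _ => IsSelfAdjoint.smul (Complex.conj_ofReal _) (hh i)
  have hfin : (spectrum ℝ A).Finite := Matrix.finite_real_spectrum
  -- The coefficients are added to the interpolation nodes because `c i` need not lie in the
  -- spectrum when `e i = 0`.
  set s : Finset ℝ := hfin.toFinset ∪ Finset.univ.image c
  set q := Lagrange.interpolate s id f
  have hq : ∀ x ∈ s, q.eval x = f x := fun x hx =>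
    Lagrange.eval_interpolate_at_node (v := id) f Function.injective_id.injOn hx
  have h1 : cfc f A = cfc (fun x => q.eval x) A :=
    cfc_congr fun x hx => (hq x (Finset.mem_union_left _ (hfin.mem_toFinset.2 hx))).symm
  rw [h1, cfc_polynomial q A hAh, hA, aeval_sum_smul_idempotents he]
  exact Finset.sum_congr rfl fun i _ => by
    rw [hq _ (Finset.mem_union_right _ (Finset.mem_image_of_mem c (Finset.mem_univ i)))]

lemma vnEntropy_sum_smul_idempotents {e : ι → Matrix d d ℂ} (he : CompleteOrthogonalIdempotents e)
    (hh : ∀ i, (e i).IsHermitian) (c : ι → ℝ) :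
    vnEntropy (∑ i, (c i : ℂ) • e i) = ∑ i, Real.negMulLog (c i) * (e i).trace.re := by
  rw [vnEntropy, cfc_sum_smul_idempotents he hh]
  simp [Matrix.trace_sum, Matrix.trace_smul]

end Idempotents

/-! ### Diagonalization -/

section Diagonal

variable {d : Type*} [Fintype d] [DecidableEq d]

/-- The Hermitian matrix with eigenbasis `W` and eigenvalues `s`. -/
def conjDiag (W : Matrix.unitaryGroup d ℂ) (s : d → ℝ) : Matrix d d ℂ :=
  (W : Matrix d d ℂ) * Matrix.diagonal (fun x => (s x : ℂ)) * (W : Matrix d d ℂ)ᴴ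

lemma unitary_conjTranspose_mul (W : Matrix.unitaryGroup d ℂ) :
    (W : Matrix d d ℂ)ᴴ * (W : Matrix d d ℂ) = 1 := W.2.1

lemma unitary_mul_conjTranspose (W : Matrix.unitaryGroup d ℂ) :
    (W : Matrix d d ℂ) * (W : Matrix d d ℂ)ᴴ = 1 := W.2.2

lemma IsHermitian.eq_conjDiag {A : Matrix d d ℂ} (hA : A.IsHermitian) :
    A = conjDiag hA.eigenvectorUnitary hA.eigenvalues := by
  conv_lhs => rw [hA.spectral_theorem]
  rw [Unitary.conjStarAlgAut_apply]
  rfl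

/-- The coarse-graining given by an orthonormal basis. -/
def basisGraining (W : Matrix.unitaryGroup d ℂ) : CoarseGraining d d where
  proj x := (W : Matrix d d ℂ) * Matrix.diagonal (Pi.single x 1) * (W : Matrix d d ℂ)ᴴ
  isHermitian x := by
    refine Matrix.isHermitian_mul_mul_conjTranspose _ ?_
    rw [Matrix.isHermitian_diagonal_iff]
    intro i
    by_cases h : i = x
    · subst h; simp [isSelfAdjoint_iff]
    · simp [h, isSelfAdjoint_iff]
  complete :=
    { idem := fun x => by
        rw [IsIdempotentElem]
        calc _ = (W : Matrix d d ℂ) * Matrix.diagonal (Pi.single x 1) *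
              ((W : Matrix d d ℂ)ᴴ * (W : Matrix d d ℂ)) * Matrix.diagonal (Pi.single x 1) *
                (W : Matrix d d ℂ)ᴴ := by simp only [Matrix.mul_assoc]
          _ = _ := by
            rw [unitary_conjTranspose_mul, Matrix.mul_one, Matrix.mul_assoc (W : Matrix d d ℂ),
              Matrix.diagonal_mul_diagonal]
            congr 3
            funext i
            by_cases h : i = x <;> simp [h]
      ortho := fun x y hxy => by
        calc _ = (W : Matrix d d ℂ) * Matrix.diagonal (Pi.single x 1) *
              ((W : Matrix d d ℂ)ᴴ * (W : Matrix d d ℂ)) * Matrix.diagonal (Pi.single y 1) *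
                (W : Matrix d d ℂ)ᴴ := by simp only [Matrix.mul_assoc]
          _ = 0 := by
            rw [unitary_conjTranspose_mul, Matrix.mul_one, Matrix.mul_assoc (W : Matrix d d ℂ),
              Matrix.diagonal_mul_diagonal]
            have : (fun i => (Pi.single x 1 : d → ℂ) i * (Pi.single y 1 : d → ℂ) i) = 0 := by
              funext i
              by_cases h : i = x
              · subst h; simp [hxy]
              · simp [h]
            rw [this]
            simp
      complete := by
        rw [← Finset.sum_mul, ← Finset.mul_sum]
        have : ∑ x : d, Matrix.diagonal (Pi.single x (1 : ℂ)) = (1 : Matrix d d ℂ) := by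
          ext i j
          by_cases h : i = j
          · subst h; simp [Matrix.sum_apply, Pi.single_apply]
          · simp [Matrix.sum_apply, h]
        rw [this, Matrix.mul_one, unitary_mul_conjTranspose] }

/-- Through this form the same idempotent calculus gives the entropy of diagonalized matrices and of
coarse-grained states. -/
lemma conjDiag_eq_sum (W : Matrix.unitaryGroup d ℂ) (s : d → ℝ) :
    conjDiag W s = ∑ x, (s x : ℂ) • (basisGraining W).proj x := by
  have : Matrix.diagonal (fun x => (s x : ℂ)) =
      ∑ x : d, (s x : ℂ) • Matrix.diagonal (Pi.single x (1 : ℂ)) := by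
    ext i j
    by_cases h : i = j
    · subst h; simp [Matrix.sum_apply, Pi.single_apply]
    · simp [Matrix.sum_apply, h]
  simp only [conjDiag, this, basisGraining, Finset.mul_sum, Finset.sum_mul, Matrix.mul_smul,
    Matrix.smul_mul]

lemma trace_conj_unitary (W : Matrix.unitaryGroup d ℂ) (A : Matrix d d ℂ) :
    ((W : Matrix d d ℂ) * A * (W : Matrix d d ℂ)ᴴ).trace = A.trace := by
  rw [Matrix.trace_mul_comm, ← Matrix.mul_assoc, unitary_conjTranspose_mul, Matrix.one_mul]

lemma trace_conjDiag (W : Matrix.unitaryGroup d ℂ) (s : d → ℝ) :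
    (conjDiag W s).trace = ((∑ x, s x : ℝ) : ℂ) := by
  rw [conjDiag, trace_conj_unitary, Matrix.trace_diagonal]
  push_cast
  rfl

lemma vnEntropy_conjDiag (W : Matrix.unitaryGroup d ℂ) (s : d → ℝ) :
    vnEntropy (conjDiag W s) = shannon s := by
  rw [conjDiag_eq_sum, vnEntropy_sum_smul_idempotents (basisGraining W).complete
    (basisGraining W).isHermitian]
  refine Finset.sum_congr rfl fun x _ => ?_
  simp [basisGraining, trace_conj_unitary, Matrix.trace_diagonal]

lemma exp_smul_conjDiag (W : Matrix.unitaryGroup d ℂ) (E : d → ℝ) (β : ℝ) :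
    NormedSpace.exp (-(β : ℂ) • conjDiag W E) = conjDiag W fun a => Real.exp (-β * E a) := by
  have hinv : (W : Matrix d d ℂ)⁻¹ = (W : Matrix d d ℂ)ᴴ :=
    Matrix.inv_eq_right_inv (unitary_mul_conjTranspose W)
  have hu : IsUnit (W : Matrix d d ℂ) := by
    rw [Matrix.isUnit_iff_isUnit_det]
    exact Matrix.isUnit_det_of_right_inverse (unitary_mul_conjTranspose W)
  have h : -(β : ℂ) • conjDiag W E = (W : Matrix d d ℂ) *
      Matrix.diagonal (fun x => ((-β * E x : ℝ) : ℂ)) * (W : Matrix d d ℂ)⁻¹ := by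
    rw [hinv, conjDiag, ← Matrix.smul_mul, ← Matrix.mul_smul, ← Matrix.diagonal_smul]
    congr 3
    funext x
    simp
  rw [h, Matrix.exp_conj _ _ hu, Matrix.exp_diagonal, hinv, conjDiag]
  congr 3
  funext x
  rw [Pi.coe_exp, ← Complex.exp_eq_exp_ℂ, Complex.ofReal_exp]

lemma gibbs_conjDiag (W : Matrix.unitaryGroup d ℂ) (E : d → ℝ) (β : ℝ) :
    gibbs (conjDiag W E) β = conjDiag W (gibbsVec E β) := by
  rw [gibbs, exp_smul_conjDiag, trace_conjDiag, conjDiag, ← Matrix.smul_mul, ← Matrix.mul_smul,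
    ← Matrix.diagonal_smul, conjDiag]
  congr 3
  funext x
  simp [gibbsVec, partitionFn, div_eq_inv_mul]

lemma continuous_conjDiag (W : Matrix.unitaryGroup d ℂ) : Continuous (conjDiag W) := by
  unfold conjDiag
  refine ((continuous_const.matrix_mul ?_).matrix_mul continuous_const)
  exact Continuous.matrix_diagonal (by fun_prop)

/-- Thermal states are those with thermal eigenvalues in the energy basis. -/
lemma isThermal_conjDiag_iff [Nonempty d] (W : Matrix.unitaryGroup d ℂ) (E : d → ℝ)
    (σ : Matrix d d ℂ) :
    IsThermal (conjDiag W E) σ ↔ ∃ s, IsThermalVec E s ∧ σ = conjDiag W s := by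
  have hlim : Tendsto (gibbs (conjDiag W E)) atTop (𝓝 (conjDiag W (groundVec E))) := by
    rw [funext (gibbs_conjDiag W E)]
    exact ((continuous_conjDiag W).tendsto _).comp (tendsto_gibbsVec E)
  constructor
  · rintro (⟨β, hβ, rfl⟩ | h)
    · exact ⟨_, Or.inl ⟨β, hβ, rfl⟩, gibbs_conjDiag W E β⟩
    · exact ⟨_, Or.inr rfl, tendsto_nhds_unique h hlim⟩
  · rintro ⟨s, ⟨β, hβ, rfl⟩ | rfl, rfl⟩
    · exact Or.inl ⟨β, hβ, (gibbs_conjDiag W E β).symm⟩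
    · exact Or.inr hlim

/-- The energy of one diagonalized matrix with respect to another. -/
lemma energy_conjDiag_conjDiag (W X : Matrix.unitaryGroup d ℂ) (E p : d → ℝ) :
    energy (conjDiag W E) (conjDiag X p) =
      ∑ x, ∑ y, Complex.normSq (((W⁻¹ * X : Matrix.unitaryGroup d ℂ) : Matrix d d ℂ) y x) * p x *
        E y := by
  set Q : Matrix d d ℂ := ((W⁻¹ * X : Matrix.unitaryGroup d ℂ) : Matrix d d ℂ) with hQ
  have hQ' : Q = (W : Matrix d d ℂ)ᴴ * (X : Matrix d d ℂ) := rfl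
  have h1 : (conjDiag W E * conjDiag X p).trace =
      (Matrix.diagonal (fun x => (E x : ℂ)) * (Q * Matrix.diagonal (fun x => (p x : ℂ)) * Qᴴ)).trace := by
    rw [hQ', Matrix.conjTranspose_mul, Matrix.conjTranspose_conjTranspose, conjDiag, conjDiag,
      Matrix.mul_assoc (W : Matrix d d ℂ), Matrix.mul_assoc (W : Matrix d d ℂ),
      Matrix.trace_mul_comm (W : Matrix d d ℂ)]
    simp only [Matrix.mul_assoc]
  rw [energy, h1, Matrix.trace, Complex.re_sum, Finset.sum_comm]
  refine Finset.sum_congr rfl fun y _ => ?_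
  rw [Matrix.diag_apply, Matrix.diagonal_mul, Matrix.mul_apply, Finset.mul_sum, Complex.re_sum]
  refine Finset.sum_congr rfl fun x _ => ?_
  rw [Matrix.mul_diagonal, Matrix.conjTranspose_apply]
  have : (E y : ℂ) * (Q y x * p x * star (Q y x)) =
      ((Complex.normSq (Q y x) * p x * E y : ℝ) : ℂ) := by
    push_cast
    rw [← Complex.mul_conj]
    simp only [RCLike.star_def]
    ring
  rw [this, Complex.ofReal_re]

/-- With `sum_normSq_col`, this makes the transition matrix of a unitary doubly stochastic, the only
trace of unitarity used in the lower bound on the energy. -/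
lemma sum_normSq_row (Q : Matrix.unitaryGroup d ℂ) (y : d) :
    ∑ x, Complex.normSq ((Q : Matrix d d ℂ) y x) = 1 := by
  have h := congrFun (congrFun (unitary_mul_conjTranspose Q) y) y
  rw [Matrix.mul_apply, Matrix.one_apply_eq] at h
  simp only [Matrix.conjTranspose_apply, RCLike.star_def, Complex.mul_conj] at h
  exact_mod_cast h

lemma sum_normSq_col (Q : Matrix.unitaryGroup d ℂ) (x : d) :
    ∑ y, Complex.normSq ((Q : Matrix d d ℂ) y x) = 1 := by
  have h := congrFun (congrFun (unitary_conjTranspose_mul Q) x) x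
  rw [Matrix.mul_apply, Matrix.one_apply_eq] at h
  simp only [Matrix.conjTranspose_apply, RCLike.star_def, mul_comm (starRingEnd ℂ _),
    Complex.mul_conj] at h
  exact_mod_cast h

lemma energy_conjDiag_self (W : Matrix.unitaryGroup d ℂ) (E s : d → ℝ) :
    energy (conjDiag W E) (conjDiag W s) = expect s E := by
  rw [energy_conjDiag_conjDiag, expect]
  refine Finset.sum_congr rfl fun x _ => ?_
  rw [Finset.sum_eq_single x]
  · simp
  · intro y _ hyx
    simp [Matrix.one_apply_ne hyx]
  · simp

lemma conj_conjDiag (U X : Matrix.unitaryGroup d ℂ) (p : d → ℝ) :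
    (U : Matrix d d ℂ) * conjDiag X p * (U : Matrix d d ℂ)ᴴ = conjDiag (U * X) p := by
  simp only [conjDiag, Matrix.UnitaryGroup.mul_val, Matrix.conjTranspose_mul, Matrix.mul_assoc]

end Diagonal

/-! ### Tensor powers -/

section Tensor

variable {d : Type*} [Fintype d] {N : ℕ}

lemma tensor_mul (A B : Fin N → Matrix d d ℂ) :
    tensor A * tensor B = tensor fun k => A k * B k := by
  ext x y
  simp only [tensor, Matrix.mul_apply, Matrix.of_apply, ← Finset.prod_mul_distrib]
  rw [Finset.prod_univ_sum, Fintype.piFinset_univ]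

omit [Fintype d] in
lemma tensor_conjTranspose (A : Fin N → Matrix d d ℂ) :
    (tensor A)ᴴ = tensor fun k => (A k)ᴴ := by
  ext x y
  simp [tensor, Matrix.conjTranspose_apply]

lemma trace_tensor (A : Fin N → Matrix d d ℂ) : (tensor A).trace = ∏ k, (A k).trace := by
  simp only [Matrix.trace, Matrix.diag_apply, tensor, Matrix.of_apply]
  rw [Finset.prod_univ_sum, Fintype.piFinset_univ]

variable [DecidableEq d]

omit [Fintype d] in
lemma tensor_diagonal (s : Fin N → d → ℂ) :
    tensor (fun k => Matrix.diagonal (s k)) = Matrix.diagonal fun x => ∏ k, s k (x k) := by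
  ext x y
  by_cases h : x = y
  · subst h; simp [tensor]
  · obtain ⟨k, hk⟩ := Function.ne_iff.1 h
    rw [Matrix.diagonal_apply_ne _ h]
    exact Finset.prod_eq_zero (Finset.mem_univ k) (Matrix.diagonal_apply_ne _ hk)

omit [Fintype d] in
lemma tensor_one : tensor (fun _ : Fin N => (1 : Matrix d d ℂ)) = 1 := by
  simp_rw [← Matrix.diagonal_one, tensor_diagonal]
  simp

/-- The tensor power of a unitary. -/
def tensorUnitary (W : Matrix.unitaryGroup d ℂ) (N : ℕ) : Matrix.unitaryGroup (Fin N → d) ℂ :=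
  ⟨tensor fun _ => (W : Matrix d d ℂ), by
    rw [Matrix.mem_unitaryGroup_iff, Matrix.star_eq_conjTranspose, tensor_conjTranspose,
      tensor_mul]
    simp_rw [unitary_mul_conjTranspose]
    exact tensor_one⟩

lemma tensor_conjDiag (W : Matrix.unitaryGroup d ℂ) (s : d → ℝ) (N : ℕ) :
    tensor (fun _ : Fin N => conjDiag W s) = conjDiag (tensorUnitary W N) (powVec s N) := by
  have h : Matrix.diagonal (fun x => (powVec s N x : ℂ)) =
      tensor fun _ : Fin N => Matrix.diagonal fun a => (s a : ℂ) := by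
    rw [tensor_diagonal]
    simp [powVec]
  conv_rhs => rw [conjDiag, h]
  simp only [tensorUnitary, tensor_conjTranspose, tensor_mul]
  rfl

lemma tensor_update_conjDiag (W : Matrix.unitaryGroup d ℂ) (E : d → ℝ) (k : Fin N) :
    tensor (Function.update (fun _ => 1) k (conjDiag W E)) =
      conjDiag (tensorUnitary W N) fun x => E (x k) := by
  have h : Matrix.diagonal (fun x : Fin N → d => (E (x k) : ℂ)) =
      tensor (Function.update (fun _ => 1) k (Matrix.diagonal fun a => (E a : ℂ))) := by
    have : (Function.update (fun _ => 1) k (Matrix.diagonal fun a => (E a : ℂ)) :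
        Fin N → Matrix d d ℂ) = fun j => Matrix.diagonal fun a => if j = k then (E a : ℂ) else 1 := by
      funext j
      by_cases hj : j = k
      · subst hj; simp
      · simp [hj]
    rw [this, tensor_diagonal]
    simp
  conv_rhs => rw [conjDiag, h]
  simp only [tensorUnitary, tensor_conjTranspose, tensor_mul]
  congr 1
  funext j
  by_cases hj : j = k
  · subst hj; simp [conjDiag]
  · simp [hj, unitary_mul_conjTranspose]

/-- The summands share the product eigenbasis, so the many-copy problem becomes one about additive
functions on sequences. -/
lemma totalHamiltonian_conjDiag (W : Matrix.unitaryGroup d ℂ) (E : d → ℝ) (N : ℕ) :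
    totalHamiltonian (conjDiag W E) N = conjDiag (tensorUnitary W N) (sumFn E N) := by
  simp only [totalHamiltonian, tensor_update_conjDiag]
  simp only [conjDiag, ← Finset.sum_mul, ← Finset.mul_sum]
  congr 2
  ext x y
  by_cases h : x = y
  · subst h; simp [Matrix.sum_apply, sumFn]
  · simp [Matrix.sum_apply, h]

lemma energy_totalHamiltonian (H : Matrix d d ℂ) {ρ : Matrix d d ℂ} (hρ : ρ.trace = 1) (N : ℕ) :
    energy (totalHamiltonian H N) (tensor fun _ => ρ) = N * energy H ρ := by
  have h : ∀ k : Fin N, (tensor (Function.update (fun _ => 1) k H) * tensor fun _ => ρ).trace =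
      (H * ρ).trace := by
    intro k
    rw [tensor_mul, trace_tensor, Finset.prod_eq_single k]
    · simp
    · intro j _ hj
      simp [hj, hρ]
    · simp
  simp only [energy, totalHamiltonian, Finset.sum_mul, Matrix.trace_sum, h]
  simp

end Tensor

/-! ### The average over the block unitaries -/

namespace CoarseGraining

variable {d ι : Type*} [Fintype d] [DecidableEq d] [Fintype ι] (C : CoarseGraining d ι) {N : ℕ}

instance : C.haarProb.IsMulLeftInvariant := by
  unfold haarProb
  infer_instance

lemma vol_eq (i : ι) : (C.proj i).trace = (C.vol i : ℂ) := by
  refine (Complex.conj_eq_iff_re.1 ?_).symm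
  have := congrArg Matrix.trace (C.isHermitian i)
  rwa [Matrix.trace_conjTranspose] at this

lemma proj_mul_proj (i : ι) : C.proj i * C.proj i = C.proj i := C.complete.idem i

lemma posSemidef_proj (i : ι) : (C.proj i).PosSemidef := by
  have h := Matrix.posSemidef_conjTranspose_mul_self (C.proj i)
  rwa [C.isHermitian i, C.proj_mul_proj] at h

lemma vol_nonneg (i : ι) : 0 ≤ C.vol i :=
  (Complex.le_def.1 (C.posSemidef_proj i).trace_nonneg).1

lemma proj_eq_zero {i : ι} (h : C.vol i = 0) : C.proj i = 0 := by
  have : (C.proj i).trace = 0 := by rw [C.vol_eq, h, Complex.ofReal_zero]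
  exact (C.posSemidef_proj i).trace_eq_zero_iff.1 this

/-- The reflection along a vector in the range of one of the projectors. -/
lemma exists_reflection (i : ι) (v : d → ℂ) (hv : C.proj i *ᵥ v = v) (h0 : v ≠ 0) :
    ∃ (U : C.blockUnitary) (t : ℂ), t ≠ 0 ∧
      ((U : Matrix.unitaryGroup d ℂ) : Matrix d d ℂ) = 1 - t • Matrix.vecMulVec v (star v) := by
  set r : ℂ := star v ⬝ᵥ v with hr
  have hr0 : r ≠ 0 := by rwa [hr, Ne, dotProduct_star_self_eq_zero]
  have hrr : star r = r := by
    rw [hr, ← Matrix.star_dotProduct]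
  set B := Matrix.vecMulVec v (star v) with hB
  have hBB : B * B = r • B := by
    rw [hB, Matrix.vecMulVec_mul_vecMulVec, Matrix.vecMulVec_smul]
  have hBh : Bᴴ = B := by
    rw [hB, Matrix.conjTranspose_vecMulVec, star_star]
  have ht : star (2 / r) = 2 / r := by
    rw [star_div₀, hrr]; simp
  -- The Householder reflection: since `B * B = r • B`, the factor `2 / r` makes it an involution.
  set A : Matrix d d ℂ := 1 - (2 / r) • B with hA
  have hAh : star A = A := by
    rw [Matrix.star_eq_conjTranspose, hA, Matrix.conjTranspose_sub, Matrix.conjTranspose_smul, hBh,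
      ht, Matrix.conjTranspose_one]
  have hAA : A * A = 1 := by
    have h4 : (2 / r) * ((2 / r) * r) = 2 / r + 2 / r := by field_simp; ring
    rw [hA, sub_mul, mul_sub, mul_sub, one_mul, mul_one, one_mul, smul_mul_smul_comm, hBB, smul_smul,
      mul_assoc, h4, add_smul]
    abel
  have hcomm : ∀ j, Commute A (C.proj j) := by
    classical
    intro j
    refine (Commute.one_left _).sub_left (Commute.smul_left ?_ _)
    have hj : C.proj j *ᵥ v = if j = i then v else 0 := by
      split_ifs with h
      · rw [h, hv]
      · rw [← hv, Matrix.mulVec_mulVec, C.complete.ortho h, Matrix.zero_mulVec]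
    have h1 : C.proj j * B = if j = i then B else 0 := by
      rw [hB, Matrix.mul_vecMulVec, hj]
      split_ifs <;> simp
    have h2 : B * C.proj j = if j = i then B else 0 := by
      have := congrArg Matrix.conjTranspose h1
      rw [Matrix.conjTranspose_mul, hBh, C.isHermitian j] at this
      rw [this]
      split_ifs <;> simp [hBh]
    rw [Commute, SemiconjBy, h1, h2]
  exact ⟨⟨⟨A, by rw [Matrix.mem_unitaryGroup_iff, hAh, hAA]⟩, hcomm⟩, 2 / r,
    div_ne_zero two_ne_zero hr0, rfl⟩

/-- A matrix that commutes with the block unitaries commutes with the projectors. -/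
lemma commute_proj {T : Matrix d d ℂ}
    (hT : ∀ U : C.blockUnitary, Commute T ((U : Matrix.unitaryGroup d ℂ) : Matrix d d ℂ))
    (i : ι) : Commute T (C.proj i) := by
  -- The reflection `1 - 2 P_i` is itself a block unitary; commuting with it is commuting with
  -- `P_i`.
  have hh : star (1 - (2 : ℂ) • C.proj i) = 1 - (2 : ℂ) • C.proj i := by
    rw [Matrix.star_eq_conjTranspose, Matrix.conjTranspose_sub, Matrix.conjTranspose_smul,
      C.isHermitian i, Matrix.conjTranspose_one]
    simp
  have hu : (1 - (2 : ℂ) • C.proj i) * star (1 - (2 : ℂ) • C.proj i) = 1 := by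
    rw [hh, sub_mul, mul_sub, mul_sub, one_mul, mul_one, one_mul, smul_mul_smul_comm,
      C.proj_mul_proj]
    module
  have hc : ∀ j, Commute (1 - (2 : ℂ) • C.proj i) (C.proj j) := by
    intro j
    refine (Commute.one_left _).sub_left (Commute.smul_left ?_ _)
    by_cases h : i = j
    · rw [h]
      exact Commute.refl _
    · rw [Commute, SemiconjBy, C.complete.ortho h, C.complete.ortho (Ne.symm h)]
  have h := (hT ⟨⟨_, Matrix.mem_unitaryGroup_iff.2 hu⟩, hc⟩).eq
  rw [mul_sub, sub_mul, mul_one, one_mul, sub_right_inj, Matrix.mul_smul, Matrix.smul_mul] at h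
  exact smul_right_injective _ two_ne_zero h

/-- A matrix that commutes with the block unitaries acts as a scalar on each range. -/
lemma vol_smul_mul_proj {T : Matrix d d ℂ}
    (hT : ∀ U : C.blockUnitary, Commute T ((U : Matrix.unitaryGroup d ℂ) : Matrix d d ℂ))
    (i : ι) :
    (C.vol i : ℂ) • (T * C.proj i) = (T * C.proj i).trace • C.proj i := by
  have hTP := (C.commute_proj hT i).eq
  have hvol := C.vol_eq i
  set P := C.proj i
  have hPP : P * P = P := C.proj_mul_proj i
  have hPh : Pᴴ = P := C.isHermitian i
  -- `P x xᴴ P` is the rank-one matrix of `P x`, a vector in the range, so commuting with the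
  -- reflection along it gives the identity.
  have hvec : ∀ x : d → ℂ, T * (P * Matrix.vecMulVec x (star x) * P) =
      P * Matrix.vecMulVec x (star x) * P * T := by
    intro x
    have hx : P * Matrix.vecMulVec x (star x) * P =
        Matrix.vecMulVec (P *ᵥ x) (star (P *ᵥ x)) := by
      rw [Matrix.mul_vecMulVec, Matrix.vecMulVec_mul, Matrix.star_mulVec, hPh]
    rw [hx]
    by_cases h0 : P *ᵥ x = 0
    · simp [h0]
    · obtain ⟨U, t, ht, hU⟩ := C.exists_reflection i (P *ᵥ x)
        (by rw [Matrix.mulVec_mulVec, hPP]) h0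
      have h := (hT U).eq
      rw [hU, mul_sub, sub_mul, mul_one, one_mul, sub_right_inj, Matrix.mul_smul,
        Matrix.smul_mul] at h
      exact smul_right_injective _ ht h
  let φ : Matrix d d ℂ →ₗ[ℂ] Matrix d d ℂ :=
    { toFun := fun M => T * (P * M * P) - P * M * P * T
      map_add' := fun A B => by simp only [mul_add, add_mul]; abel
      map_smul' := fun c A => by
        simp only [Matrix.mul_smul, Matrix.smul_mul, smul_sub, RingHom.id_apply] }
  have hφ : ∀ x : d → ℂ, φ (Matrix.vecMulVec x (star x)) = 0 := fun x => sub_eq_zero.2 (hvec x)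
  -- Polarization: a linear map that vanishes on `x xᴴ` for `x = u, w, u + w, u + i w` also vanishes
  -- on `u wᴴ`.
  have hsingle : ∀ a b : d, φ (Matrix.vecMulVec (Pi.single a 1) (Pi.single b 1)) = 0 := by
    intro a b
    set u : d → ℂ := Pi.single a 1
    set w : d → ℂ := Pi.single b 1
    have hu : star u = u := by simp [u]
    have hw : star w = w := by simp [w]
    have h1 := hφ (u + w)
    have h2 := hφ (u + Complex.I • w)
    have h3 := hφ u
    have h4 := hφ w
    rw [hu] at h3
    rw [hw] at h4
    simp only [star_add, star_smul, hu, hw, Matrix.add_vecMulVec, Matrix.vecMulVec_add,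
      Matrix.smul_vecMulVec, Matrix.vecMulVec_smul, map_add, map_smul, h3, h4, smul_zero, add_zero,
      zero_add] at h1 h2
    have h5 : φ (Matrix.vecMulVec w u) = -φ (Matrix.vecMulVec u w) :=
      eq_neg_of_add_eq_zero_left h1
    rw [h5] at h2
    have h6 : (-(2 * Complex.I)) • φ (Matrix.vecMulVec u w) = 0 := by
      rw [← h2, RCLike.star_def, Complex.conj_I]
      module
    exact (smul_eq_zero.1 h6).resolve_left (by simp)
  ext c a
  -- This is the `(c, b)` entry of the commutation with the compressed matrix unit `(a, b)`. Summing
  -- over `b` produces the traces, with no division by the volume.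
  have h : ∀ b, (T * P) c a * P b b = P c a * (P * T) b b := by
    intro b
    have h := congrFun (congrFun (sub_eq_zero.1 (hsingle a b)) c) b
    have e1 : T * (P * Matrix.vecMulVec (Pi.single a 1) (Pi.single b 1) * P) =
        Matrix.vecMulVec ((T * P) *ᵥ Pi.single a 1) (Pi.single b 1 ᵥ* P) := by
      rw [Matrix.mul_vecMulVec, Matrix.vecMulVec_mul, Matrix.mul_vecMulVec, Matrix.mulVec_mulVec]
    have e2 : P * Matrix.vecMulVec (Pi.single a 1) (Pi.single b 1) * P * T =
        Matrix.vecMulVec (P *ᵥ Pi.single a 1) (Pi.single b 1 ᵥ* (P * T)) := by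
      rw [Matrix.mul_vecMulVec, Matrix.vecMulVec_mul, Matrix.vecMulVec_mul, Matrix.vecMul_vecMul]
    rw [e1, e2] at h
    simpa [Matrix.vecMulVec_apply] using h
  calc (C.vol i : ℂ) * (T * P) c a = ∑ b, (T * P) c a * P b b := by
        rw [← hvol, mul_comm, Matrix.trace, Finset.mul_sum]
        rfl
    _ = ∑ b, P c a * (T * P) b b := Finset.sum_congr rfl fun b _ => by rw [h b, hTP]
    _ = (T * P).trace * P c a := by
        rw [← Finset.mul_sum, mul_comm]
        rfl

/-- The conjugate `V ρ Vᴴ` of `ρ` by a block unitary. -/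
def conj (ρ : Matrix d d ℂ) (V : C.blockUnitary) : Matrix d d ℂ :=
  ((V : Matrix.unitaryGroup d ℂ) : Matrix d d ℂ) * ρ *
    ((V : Matrix.unitaryGroup d ℂ) : Matrix d d ℂ)ᴴ

lemma continuous_conj (ρ : Matrix d d ℂ) : Continuous (C.conj ρ) := by
  have h : Continuous fun V : C.blockUnitary =>
      ((V : Matrix.unitaryGroup d ℂ) : Matrix d d ℂ) :=
    continuous_subtype_val.comp continuous_subtype_val
  exact (h.matrix_mul continuous_const).matrix_mul h.matrix_conjTranspose

lemma integrable_conj (ρ : Matrix d d ℂ) (a b : d) :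
    Integrable (fun V => C.conj ρ V a b) C.haarProb :=
  ((C.continuous_conj ρ).matrix_elem a b).integrable_of_hasCompactSupport
    (HasCompactSupport.of_compactSpace _)

/-- The average of `ρ` over the block unitaries. -/
def twirl (ρ : Matrix d d ℂ) : Matrix d d ℂ :=
  Matrix.of fun a b => ∫ V, C.conj ρ V a b ∂C.haarProb

lemma conj_mul (ρ : Matrix d d ℂ) (U V : C.blockUnitary) :
    C.conj ρ (U * V) = ((U : Matrix.unitaryGroup d ℂ) : Matrix d d ℂ) * C.conj ρ V *
      ((U : Matrix.unitaryGroup d ℂ) : Matrix d d ℂ)ᴴ := by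
  simp only [conj, Subgroup.coe_mul, Matrix.UnitaryGroup.mul_val, Matrix.conjTranspose_mul,
    Matrix.mul_assoc]

/-- Since the twirl is an entrywise integral, fixed factors pass through it by linearity of finite
sums. -/
lemma mul_twirl_mul (ρ A B : Matrix d d ℂ) (a b : d) :
    (A * C.twirl ρ * B) a b = ∫ V, (A * C.conj ρ V * B) a b ∂C.haarProb := by
  simp only [Matrix.mul_apply, twirl, Matrix.of_apply, Finset.sum_mul]
  rw [integral_finsetSum _ fun j _ => integrable_finsetSum _ fun k _ =>
    ((C.integrable_conj ρ k j).const_mul _).mul_const _]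
  refine Finset.sum_congr rfl fun j _ => ?_
  rw [integral_finsetSum _ fun k _ => ((C.integrable_conj ρ k j).const_mul _).mul_const _]
  refine Finset.sum_congr rfl fun k _ => ?_
  rw [integral_mul_const, integral_const_mul]

/-- Conjugation by `U` replaces `V` by `U * V` under the integral, which left invariance ignores. -/
lemma commute_twirl (ρ : Matrix d d ℂ) (U : C.blockUnitary) :
    Commute (C.twirl ρ) ((U : Matrix.unitaryGroup d ℂ) : Matrix d d ℂ) := by
  have h : ((U : Matrix.unitaryGroup d ℂ) : Matrix d d ℂ) * C.twirl ρ *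
      ((U : Matrix.unitaryGroup d ℂ) : Matrix d d ℂ)ᴴ = C.twirl ρ := by
    ext a b
    rw [mul_twirl_mul]
    simp_rw [← C.conj_mul]
    exact integral_mul_left_eq_self (fun V => C.conj ρ V a b) U
  have h2 := congrArg (· * ((U : Matrix.unitaryGroup d ℂ) : Matrix d d ℂ)) h
  simp only [Matrix.mul_assoc, unitary_conjTranspose_mul, Matrix.mul_one] at h2
  exact h2.symm

/-- The integrand is constant: `V` commutes with the projector and cancels cyclically under the
trace. -/
lemma trace_twirl_mul_proj (ρ : Matrix d d ℂ) (i : ι) :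
    (C.twirl ρ * C.proj i).trace = (C.proj i * ρ).trace := by
  have h : ∀ V : C.blockUnitary, (C.conj ρ V * C.proj i).trace = (C.proj i * ρ).trace := by
    intro V
    have hV := (V.2 i).eq
    have hU := unitary_conjTranspose_mul V.1
    rw [conj, Matrix.trace_mul_comm, ← Matrix.mul_assoc, ← Matrix.mul_assoc, ← hV,
      Matrix.trace_mul_comm, ← Matrix.mul_assoc, ← Matrix.mul_assoc, hU, Matrix.one_mul]
  have h1 : (C.twirl ρ * C.proj i).trace = ∫ V, (C.conj ρ V * C.proj i).trace ∂C.haarProb := by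
    have hm : ∀ a, (C.twirl ρ * C.proj i) a a = ∫ V, (C.conj ρ V * C.proj i) a a ∂C.haarProb := by
      intro a
      simpa using C.mul_twirl_mul ρ 1 (C.proj i) a a
    simp only [Matrix.trace, Matrix.diag_apply, hm]
    rw [integral_finsetSum]
    intro a _
    simp only [Matrix.mul_apply]
    exact integrable_finsetSum _ fun k _ => (C.integrable_conj ρ a k).mul_const _
  rw [h1]
  simp [h]

lemma prob_eq {ρ : Matrix d d ℂ} (hρ : ρ.IsHermitian) (i : ι) :
    (C.proj i * ρ).trace = (C.prob ρ i : ℂ) := by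
  refine (Complex.conj_eq_iff_re.1 ?_).symm
  have h := Matrix.trace_conjTranspose (C.proj i * ρ)
  rw [Matrix.conjTranspose_mul, C.isHermitian i, hρ, Matrix.trace_mul_comm] at h
  exact h.symm

/-- The average of a state over the block unitaries is the coarse-grained state. -/
lemma twirl_eq_coarseState {ρ : Matrix d d ℂ} (hρ : ρ.IsHermitian) :
    C.twirl ρ = C.coarseState ρ := by
  rw [← Matrix.mul_one (C.twirl ρ), ← C.complete.complete, Finset.mul_sum, coarseState]
  refine Finset.sum_congr rfl fun i _ => ?_
  -- An outcome of zero volume has zero projector, so the junk value of `p_i / V_i` does no harm.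
  by_cases h0 : C.vol i = 0
  · simp [C.proj_eq_zero h0]
  have h0' : (C.vol i : ℂ) ≠ 0 := Complex.ofReal_ne_zero.2 h0
  refine smul_right_injective _ h0' ?_
  simp only
  rw [C.vol_smul_mul_proj (C.commute_twirl ρ), C.trace_twirl_mul_proj, C.prob_eq hρ, smul_smul]
  congr 1
  push_cast
  field_simp

lemma prob_nonneg {ρ : Matrix d d ℂ} (hρ : ρ.PosSemidef) (i : ι) : 0 ≤ C.prob ρ i := by
  have h := (hρ.conjTranspose_mul_mul_same (C.proj i)).trace_nonneg
  rw [C.isHermitian i, Matrix.trace_mul_comm, ← Matrix.mul_assoc, C.proj_mul_proj] at h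
  exact (Complex.le_def.1 h).1

lemma sum_prob (ρ : Matrix d d ℂ) : ∑ i, C.prob ρ i = ρ.trace.re := by
  simp only [prob]
  rw [← Complex.re_sum, ← Matrix.trace_sum, ← Finset.sum_mul, C.complete.complete, Matrix.one_mul]

lemma prob_eq_zero (ρ : Matrix d d ℂ) {i : ι} (h : C.vol i = 0) : C.prob ρ i = 0 := by
  simp [prob, C.proj_eq_zero h]

lemma isDensityMatrix_coarseState {ρ : Matrix d d ℂ} (hρ : IsDensityMatrix ρ) :
    IsDensityMatrix (C.coarseState ρ) where
  posSemidef := by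
    refine Matrix.posSemidef_sum _ fun i _ => (C.posSemidef_proj i).smul ?_
    exact_mod_cast div_nonneg (C.prob_nonneg hρ.posSemidef i) (C.vol_nonneg i)
  trace_eq_one := by
    have h : ∀ i, ((C.prob ρ i / C.vol i : ℝ) : ℂ) * (C.vol i : ℂ) = (C.prob ρ i : ℂ) := by
      intro i
      rw [← Complex.ofReal_mul, div_mul_cancel_of_imp (C.prob_eq_zero ρ)]
    simp only [coarseState, Matrix.trace_sum, Matrix.trace_smul, C.vol_eq, smul_eq_mul, h]
    rw [← Complex.ofReal_sum, C.sum_prob, hρ.trace_eq_one]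
    simp

/-- The observational entropy is the entropy of the coarse-grained state. -/
lemma vnEntropy_coarseState (ρ : Matrix d d ℂ) :
    vnEntropy (C.coarseState ρ) = C.obsEntropy ρ := by
  rw [coarseState, vnEntropy_sum_smul_idempotents C.complete C.isHermitian, obsEntropy,
    ← Finset.sum_neg_distrib, ← Finset.sum_add_distrib]
  refine Finset.sum_congr rfl fun i _ => ?_
  change _ * C.vol i = _
  by_cases hv : C.vol i = 0
  · simp [hv, C.prob_eq_zero ρ hv]
  by_cases hp : C.prob ρ i = 0
  · simp [hp]
  rw [Real.negMulLog, Real.log_div hp hv]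
  field_simp
  ring

lemma trace_mul_tensor_conj (A : Matrix (Fin N → d) (Fin N → d) ℂ) (ρ : Matrix d d ℂ)
    (V : Fin N → C.blockUnitary) :
    (A * tensor fun k => C.conj ρ (V k)).trace =
      ∑ x, ∑ y, A x y * ∏ k, C.conj ρ (V k) (y k) (x k) := by
  simp only [Matrix.trace, Matrix.diag_apply, Matrix.mul_apply, tensor, Matrix.of_apply]

lemma integrable_tensor_conj (ρ : Matrix d d ℂ) (x y : Fin N → d) :
    Integrable (fun V : Fin N → C.blockUnitary => ∏ k, C.conj ρ (V k) (y k) (x k))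
      (Measure.pi fun _ => C.haarProb) :=
  Integrable.fintype_prod fun k => C.integrable_conj ρ (y k) (x k)

/-- The average energy is the energy of the averaged state. -/
lemma integral_trace_mul_tensor (A : Matrix (Fin N → d) (Fin N → d) ℂ) (ρ : Matrix d d ℂ) :
    Integrable (fun V : Fin N → C.blockUnitary => (A * tensor fun k => C.conj ρ (V k)).trace)
        (Measure.pi fun _ => C.haarProb) ∧
      ∫ V : Fin N → C.blockUnitary, (A * tensor fun k => C.conj ρ (V k)).trace
        ∂(Measure.pi fun _ => C.haarProb) = (A * tensor fun _ => C.twirl ρ).trace := by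
  have hi : ∀ x y, Integrable
      (fun V : Fin N → C.blockUnitary => A x y * ∏ k, C.conj ρ (V k) (y k) (x k))
      (Measure.pi fun _ => C.haarProb) := fun x y => (C.integrable_tensor_conj ρ x y).const_mul _
  simp only [trace_mul_tensor_conj]
  refine ⟨integrable_finsetSum _ fun x _ => integrable_finsetSum _ fun y _ => hi x y, ?_⟩
  rw [integral_finsetSum _ fun x _ => integrable_finsetSum _ fun y _ => hi x y, Matrix.trace]
  refine Finset.sum_congr rfl fun x _ => ?_
  rw [integral_finsetSum _ fun y _ => hi x y, Matrix.diag_apply, Matrix.mul_apply]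
  refine Finset.sum_congr rfl fun y _ => ?_
  -- Independence of the copies enters here: the integral of the product is the product of the
  -- integrals.
  rw [integral_const_mul,
    integral_fintype_prod_eq_prod fun k (V : C.blockUnitary) => C.conj ρ V (y k) (x k)]
  rfl

end CoarseGraining

/-! ### Reduction of the average work to the coarse-grained state -/

section Work

variable {d ι : Type*} [Fintype d] [DecidableEq d] [Fintype ι]

/-- The average work, with the average over the block unitaries carried out. -/
lemma averageWork_eq (H : Matrix d d ℂ) (C : CoarseGraining d ι) {ρ : Matrix d d ℂ}
    (hρ : IsDensityMatrix ρ) (N : ℕ) (U : Matrix.unitaryGroup (Fin N → d) ℂ) :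
    averageWork H C ρ N U = N * energy H ρ - energy (totalHamiltonian H N)
      ((U : Matrix (Fin N → d) (Fin N → d) ℂ) * (tensor fun _ => C.coarseState ρ) *
        (U : Matrix (Fin N → d) (Fin N → d) ℂ)ᴴ) := by
  -- In the Heisenberg picture the final energy is linear in the randomized state, so the average
  -- passes to that state.
  set A := (U : Matrix (Fin N → d) (Fin N → d) ℂ)ᴴ * totalHamiltonian H N *
    (U : Matrix (Fin N → d) (Fin N → d) ℂ) with hA
  have hcyc : ∀ B : Matrix (Fin N → d) (Fin N → d) ℂ, energy (totalHamiltonian H N)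
      ((U : Matrix (Fin N → d) (Fin N → d) ℂ) * B * (U : Matrix (Fin N → d) (Fin N → d) ℂ)ᴴ) =
        (A * B).trace.re := by
    intro B
    rw [energy, hA, ← Matrix.mul_assoc, Matrix.trace_mul_comm]
    simp only [Matrix.mul_assoc]
  have hrun : ∀ V : Fin N → C.blockUnitary, singleRunWork H C ρ N U V =
      N * energy H ρ - (A * tensor fun k => C.conj ρ (V k)).trace.re := by
    intro V
    rw [singleRunWork, hcyc, energy_totalHamiltonian H hρ.trace_eq_one, tensor_conjTranspose,
      tensor_mul, tensor_mul]
    rfl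
  obtain ⟨hi, hint⟩ := C.integral_trace_mul_tensor A ρ
  rw [hcyc, ← C.twirl_eq_coarseState hρ.posSemidef.isHermitian, ← hint, averageWork]
  simp only [hrun]
  have hre : Integrable (fun V : Fin N → C.blockUnitary =>
      (A * tensor fun k => C.conj ρ (V k)).trace.re) (Measure.pi fun _ => C.haarProb) := hi.re
  rw [integral_sub (integrable_const _) hre, integral_const]
  congr 1
  · simp
  · exact integral_re hi

end Work

/-! ### The optimal work -/

section Ergotropy

variable {d : Type*} [Fintype d] [DecidableEq d]

/-- The block unitaries of the trivial coarse-graining are all unitaries, so their compactness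
carries over. -/
lemma compactSpace_unitaryGroup : CompactSpace (Matrix.unitaryGroup d ℂ) := by
  let C : CoarseGraining d Unit :=
    { proj := fun _ => 1
      isHermitian := fun _ => Matrix.isHermitian_one
      complete :=
        { idem := fun _ => IsIdempotentElem.one
          ortho := fun i j h => (h (Subsingleton.elim i j)).elim
          complete := by simp } }
  have hs : Function.Surjective (fun U : C.blockUnitary => (U : Matrix.unitaryGroup d ℂ)) :=
    fun U => ⟨⟨U, fun _ => Commute.one_right _⟩, rfl⟩
  exact hs.compactSpace continuous_subtype_val

/-- The energy of `U τ Uᴴ` has a minimum over the unitaries `U`. -/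
lemma exists_isMinOn_energy (H τ : Matrix d d ℂ) : ∃ U₀ : Matrix.unitaryGroup d ℂ,
    ∀ U : Matrix.unitaryGroup d ℂ,
      energy H ((U₀ : Matrix d d ℂ) * τ * (U₀ : Matrix d d ℂ)ᴴ) ≤
        energy H ((U : Matrix d d ℂ) * τ * (U : Matrix d d ℂ)ᴴ) := by
  have := compactSpace_unitaryGroup (d := d)
  have hc : Continuous fun U : Matrix.unitaryGroup d ℂ => (U : Matrix d d ℂ) :=
    continuous_subtype_val
  have hcont : Continuous fun U : Matrix.unitaryGroup d ℂ =>
      energy H ((U : Matrix d d ℂ) * τ * (U : Matrix d d ℂ)ᴴ) :=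
    Complex.continuous_re.comp (continuous_const.matrix_mul
      ((hc.matrix_mul continuous_const).matrix_mul hc.matrix_conjTranspose)).matrix_trace
  obtain ⟨U₀, -, h⟩ := isCompact_univ.exists_isMinOn Set.univ_nonempty hcont.continuousOn
  exact ⟨U₀, fun U => h (Set.mem_univ U)⟩

/-- The unitary that permutes the standard basis. -/
def permUnitary (π : Equiv.Perm d) : Matrix.unitaryGroup d ℂ :=
  ⟨Matrix.of fun y x => if y = π x then 1 else 0, by
    rw [Matrix.mem_unitaryGroup_iff]
    ext y z
    rw [Matrix.mul_apply, Finset.sum_eq_single (π.symm y)]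
    · by_cases h : y = z
      · subst h; simp [Matrix.star_apply]
      · simp [Matrix.star_apply, Matrix.one_apply_ne h, Ne.symm h]
    · intro x _ hx
      have : y ≠ π x := fun h => hx (by rw [h, Equiv.symm_apply_apply])
      simp [this]
    · simp⟩

/-- `W * permUnitary π * X⁻¹` sends the eigenvector `x` of the state to the energy eigenvector `π
x`; such unitaries suffice asymptotically. -/
lemma energy_permUnitary (W X : Matrix.unitaryGroup d ℂ) (E p : d → ℝ) (π : Equiv.Perm d) :
    energy (conjDiag W E) (conjDiag (W * permUnitary π * X⁻¹ * X) p) = ∑ x, p x * E (π x) := by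
  rw [energy_conjDiag_conjDiag]
  have h : W⁻¹ * (W * permUnitary π * X⁻¹ * X) = permUnitary π := by group
  rw [h]
  refine Finset.sum_congr rfl fun x _ => ?_
  rw [Finset.sum_eq_single (π x)]
  · simp [permUnitary]
  · intro y _ hy
    simp [permUnitary, hy]
  · simp

/-- The final energy is at least that of the thermal state of the same entropy. -/
lemma mul_expect_le_energy [Nonempty d] {E p s : d → ℝ} (hp : IsProbVec p)
    (hs : IsThermalVec E s) (hS : shannon s = shannon p) {N : ℕ}
    (W X : Matrix.unitaryGroup (Fin N → d) ℂ) :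
    N * expect s E ≤ energy (conjDiag W (sumFn E N)) (conjDiag X (powVec p N)) := by
  rw [energy_conjDiag_conjDiag]
  set Q := W⁻¹ * X
  set M : (Fin N → d) → (Fin N → d) → ℝ :=
    fun y x => Complex.normSq ((Q : Matrix (Fin N → d) (Fin N → d) ℂ) y x)
  have hM : ∀ y x, 0 ≤ M y x := fun y x => Complex.normSq_nonneg _
  have hrow : ∀ y, ∑ x, M y x = 1 := sum_normSq_row Q
  have hcol : ∀ x, ∑ y, M y x = 1 := sum_normSq_col Q
  have hP := hp.powVec N
  have htot : ∑ x, (∑ y, M y x) * powVec p N x = 1 := by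
    simp_rw [hcol, one_mul, hP.sum_eq_one]
  change N * expect s E ≤ ∑ x, ∑ y, M y x * powVec p N x * sumFn E N y
  rcases hs with ⟨β, hβ, rfl⟩ | rfl
  · rcases hβ.eq_or_lt with rfl | hβ
    -- At β = 0 Klein's inequality says nothing about energy, but maximal entropy makes `p`, hence
    -- `p^N`, uniform, and no unitary changes its energy.
    · have hpu : p = fun _ => (Fintype.card d : ℝ)⁻¹ :=
        eq_uniform_of_shannon_eq hp (by rw [← hS, gibbsVec_zero, shannon_uniform])
      rw [gibbsVec_zero, ← hpu, ← expect_powVec_sumFn hp, expect, Finset.sum_comm]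
      have hconst : ∀ x y : Fin N → d, powVec p N x = powVec p N y := by
        intro x y
        simp [powVec, hpu]
      refine le_of_eq (Finset.sum_congr rfl fun y _ => ?_)
      rw [← Finset.sum_mul]
      congr 1
      calc powVec p N y = ∑ x, M y x * powVec p N y := by rw [← Finset.sum_mul, hrow, one_mul]
        _ = ∑ x, M y x * powVec p N x := Finset.sum_congr rfl fun x _ => by rw [hconst x y]
    -- Comparison with the Gibbs vector of the total energy: entropy and log-partition function are
    -- both N times their one-copy values, so the latter cancels.
    · have hK := shannon_le_of_doublyStochastic hM hrow hcol hP
        (isProbVec_gibbsVec (sumFn E N) β) (gibbsVec_pos (sumFn E N) β)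
      have h : ∀ x y, M y x * powVec p N x * -Real.log (gibbsVec (sumFn E N) β y) =
          β * (M y x * powVec p N x * sumFn E N y) +
            M y x * powVec p N x * Real.log (partitionFn (sumFn E N) β) := by
        intro x y
        rw [neg_log_gibbsVec]
        ring
      simp_rw [h, Finset.sum_add_distrib, ← Finset.sum_mul] at hK
      rw [htot, shannon_powVec hp, ← hS, shannon_gibbsVec, partitionFn_sumFn, Real.log_pow] at hK
      simp_rw [← Finset.mul_sum] at hK
      refine le_of_mul_le_mul_left ?_ hβ
      linarith
  · calc N * expect (groundVec E) E
        = ∑ x, ∑ y, M y x * powVec p N x * (N * expect (groundVec E) E) := by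
          simp_rw [← Finset.sum_mul]
          rw [htot, one_mul]
      _ ≤ _ := by
          refine Finset.sum_le_sum fun x _ => Finset.sum_le_sum fun y _ =>
            mul_le_mul_of_nonneg_left ?_ (mul_nonneg (hM y x) (hP.nonneg x))
          calc (N : ℝ) * expect (groundVec E) E = ∑ _k : Fin N, expect (groundVec E) E := by simp
            _ ≤ sumFn E N y := Finset.sum_le_sum fun k _ => expect_groundVec_le E _

/-- For many copies some unitary reaches almost the energy of the thermal state of the same
entropy. -/
lemma exists_energy_le [Nonempty d] {E p s : d → ℝ} (hp : IsProbVec p) (hs : IsProbVec s)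
    (hS : shannon s = shannon p) {ε : ℝ} (hε : 0 < ε) :
    ∀ᶠ N : ℕ in atTop, ∀ W X : Matrix.unitaryGroup (Fin N → d) ℂ,
      ∃ U : Matrix.unitaryGroup (Fin N → d) ℂ,
        energy (conjDiag W (sumFn E N)) (conjDiag (U * X) (powVec p N)) ≤
          N * (expect s E + ε) := by
  -- At maximal entropy no `q` of larger entropy exists; there `p` and `s` are both uniform and the
  -- identity permutation is enough.
  rcases (shannon_le_log_card hs).eq_or_lt with hmax | hlt
  · refine Eventually.of_forall fun N W X => ⟨W * permUnitary 1 * X⁻¹, ?_⟩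
    have hps : p = s := by
      rw [eq_uniform_of_shannon_eq hs hmax, eq_uniform_of_shannon_eq hp (hS ▸ hmax)]
    rw [energy_permUnitary, ← hps]
    refine (expect_powVec_sumFn hp E N).le.trans ?_
    gcongr
    linarith
  · obtain ⟨q, hq, hpos, hSq, hEq⟩ := exists_shannon_lt hs hlt E (half_pos hε)
    filter_upwards [exists_perm_energy_le hp hq hpos (hS ▸ hSq) E (half_pos hε)] with N hN W X
    obtain ⟨π, hπ⟩ := hN
    refine ⟨W * permUnitary π * X⁻¹, ?_⟩
    rw [energy_permUnitary]
    exact hπ.trans (mul_le_mul_of_nonneg_left (by linarith) (Nat.cast_nonneg N))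

omit [DecidableEq d] in
lemma IsDensityMatrix.nonempty {ρ : Matrix d d ℂ} (hρ : IsDensityMatrix ρ) : Nonempty d := by
  by_contra h
  rw [not_nonempty_iff] at h
  have := hρ.trace_eq_one
  simp [Matrix.trace] at this

lemma IsDensityMatrix.exists_eq_conjDiag {ρ : Matrix d d ℂ} (hρ : IsDensityMatrix ρ) :
    ∃ (X : Matrix.unitaryGroup d ℂ) (p : d → ℝ), IsProbVec p ∧ ρ = conjDiag X p := by
  have h := IsHermitian.eq_conjDiag hρ.posSemidef.isHermitian
  refine ⟨_, _, ⟨hρ.posSemidef.eigenvalues_nonneg, ?_⟩, h⟩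
  have ht := trace_conjDiag hρ.posSemidef.isHermitian.eigenvectorUnitary
    hρ.posSemidef.isHermitian.eigenvalues
  rw [← h, hρ.trace_eq_one] at ht
  exact_mod_cast ht.symm

variable {ι : Type*} [Fintype ι]

/-- The maximum of the average work is attained, by a unitary that depends on the probabilities
only. -/
lemma exists_isGreatest_averageWork (H : Matrix d d ℂ) (C : CoarseGraining d ι)
    (ρ : Matrix d d ℂ) (N : ℕ) : ∃ U : Matrix.unitaryGroup (Fin N → d) ℂ,
      ∀ ρ' : Matrix d d ℂ, IsDensityMatrix ρ' → C.prob ρ' = C.prob ρ →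
        IsGreatest (Set.range (averageWork H C ρ' N)) (averageWork H C ρ' N U) := by
  obtain ⟨U, hU⟩ := exists_isMinOn_energy (totalHamiltonian H N)
    (tensor fun _ : Fin N => C.coarseState ρ)
  refine ⟨U, fun ρ' hρ' hprob => ⟨⟨U, rfl⟩, ?_⟩⟩
  rintro _ ⟨U', rfl⟩
  have hcg : C.coarseState ρ' = C.coarseState ρ := by
    simp only [CoarseGraining.coarseState, hprob]
  rw [averageWork_eq H C hρ', averageWork_eq H C hρ', hcg]
  -- The initial energy varies with `ρ'` but not with the unitary, so minimizing the final energy is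
  -- optimal for all `ρ'` at once.
  exact sub_le_sub_left (hU U') _

/-- The observational ergotropy per copy tends to the energy difference to the thermal state. -/
lemma tendsto_obsErgotropy_div (W : Matrix.unitaryGroup d ℂ) (E : d → ℝ) (C : CoarseGraining d ι)
    {ρ : Matrix d d ℂ} (hρ : IsDensityMatrix ρ) {s : d → ℝ} (hs : IsThermalVec E s)
    (hS : shannon s = C.obsEntropy ρ) :
    Tendsto (fun N : ℕ => obsErgotropy (conjDiag W E) C ρ N / N) atTop
      (𝓝 (energy (conjDiag W E) ρ - expect s E)) := by
  have : Nonempty d := hρ.nonempty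
  obtain ⟨X, p, hp, hX⟩ := (C.isDensityMatrix_coarseState hρ).exists_eq_conjDiag
  rw [← C.vnEntropy_coarseState, hX, vnEntropy_conjDiag] at hS
  have hwork : ∀ (N : ℕ) (U : Matrix.unitaryGroup (Fin N → d) ℂ),
      averageWork (conjDiag W E) C ρ N U = N * energy (conjDiag W E) ρ -
        energy (conjDiag (tensorUnitary W N) (sumFn E N))
          (conjDiag (U * tensorUnitary X N) (powVec p N)) := by
    intro N U
    rw [averageWork_eq _ C hρ, hX, tensor_conjDiag, totalHamiltonian_conjDiag, conj_conjDiag]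
  have hle : ∀ (N : ℕ) (U : Matrix.unitaryGroup (Fin N → d) ℂ),
      averageWork (conjDiag W E) C ρ N U ≤ N * (energy (conjDiag W E) ρ - expect s E) := by
    intro N U
    have := mul_expect_le_energy hp hs hS (tensorUnitary W N) (U * tensorUnitary X N)
    rw [hwork, mul_sub]
    linarith
  rw [Metric.tendsto_nhds]
  intro ε hε
  filter_upwards [exists_energy_le (E := E) hp hs.isProbVec hS (half_pos hε),
    eventually_gt_atTop 0] with N hN hpos
  have hN' : (0 : ℝ) < N := by exact_mod_cast hpos
  have hup : obsErgotropy (conjDiag W E) C ρ N / N ≤ energy (conjDiag W E) ρ - expect s E := by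
    rw [div_le_iff₀ hN', mul_comm]
    exact ciSup_le (hle N)
  obtain ⟨U, hU⟩ := hN (tensorUnitary W N) (tensorUnitary X N)
  have hlow : energy (conjDiag W E) ρ - expect s E - ε / 2 ≤
      obsErgotropy (conjDiag W E) C ρ N / N := by
    rw [le_div_iff₀ hN']
    -- A real supremum dominates its members only if the range is bounded; the thermal bound `hle`
    -- supplies this.
    have hbdd : BddAbove (Set.range (averageWork (conjDiag W E) C ρ N)) :=
      ⟨_, by rintro _ ⟨U, rfl⟩; exact hle N U⟩
    refine le_trans ?_ (le_ciSup hbdd U)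
    rw [hwork]
    linarith
  rw [Real.dist_eq, abs_lt]
  constructor <;> linarith

end Ergotropy

end ObsErgo

end

/-! ### Transfer to the given Hamiltonian through its eigenbasis -/

theorem mainTheorem2 {d ι : Type*} [Fintype d] [DecidableEq d] [Fintype ι]
    (H : Matrix d d ℂ) (hH : H.IsHermitian) (C : ObsErgo.CoarseGraining d ι)
    (ρ : Matrix d d ℂ) (hρ : ObsErgo.IsDensityMatrix ρ) :
    -- the observational entropy is the entropy of the coarse-grained state
    ObsErgo.vnEntropy (C.coarseState ρ) = C.obsEntropy ρ ∧
    -- the maximum over `U` is attained, by a unitary that depends on the probabilities only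
    (∀ N : ℕ, ∃ U : Matrix.unitaryGroup (Fin N → d) ℂ,
      ∀ ρ' : Matrix d d ℂ, ObsErgo.IsDensityMatrix ρ' → C.prob ρ' = C.prob ρ →
        IsGreatest (Set.range (ObsErgo.averageWork H C ρ' N))
          (ObsErgo.averageWork H C ρ' N U)) ∧
    -- there is exactly one thermal state whose entropy is the observational entropy
    (Real.log (ObsErgo.groundDegeneracy hH) ≤ C.obsEntropy ρ →
      ∃! σ : Matrix d d ℂ, ObsErgo.IsThermal H σ ∧ ObsErgo.vnEntropy σ = C.obsEntropy ρ) ∧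
    -- the work per copy in the limit of many copies
    (∀ σ : Matrix d d ℂ, ObsErgo.IsThermal H σ → ObsErgo.vnEntropy σ = C.obsEntropy ρ →
      Tendsto (fun N : ℕ => ObsErgo.obsErgotropy H C ρ N / N) atTop
        (𝓝 (ObsErgo.energy H (ρ - σ)))) := by
  have : Nonempty d := hρ.nonempty
  have hdiag := ObsErgo.IsHermitian.eq_conjDiag hH
  set W := hH.eigenvectorUnitary
  refine ⟨C.vnEntropy_coarseState ρ, ObsErgo.exists_isGreatest_averageWork H C ρ, fun hg => ?_,
    fun σ hσ hS => ?_⟩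
  · have hmax : C.obsEntropy ρ ≤ Real.log (Fintype.card d) := by
      obtain ⟨X, p, hp, hX⟩ := (C.isDensityMatrix_coarseState hρ).exists_eq_conjDiag
      rw [← C.vnEntropy_coarseState, hX, ObsErgo.vnEntropy_conjDiag]
      exact ObsErgo.shannon_le_log_card hp
    obtain ⟨s, hs, hS⟩ := ObsErgo.exists_isThermalVec hH.eigenvalues
      ((ObsErgo.shannon_groundVec _).le.trans hg) hmax
    refine ⟨ObsErgo.conjDiag W s, ⟨?_, by rw [ObsErgo.vnEntropy_conjDiag, hS]⟩, ?_⟩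
    · rw [hdiag]
      exact (ObsErgo.isThermal_conjDiag_iff W _ _).2 ⟨s, hs, rfl⟩
    · rintro τ ⟨hτ, hSτ⟩
      rw [hdiag, ObsErgo.isThermal_conjDiag_iff] at hτ
      obtain ⟨t, ht, rfl⟩ := hτ
      rw [ObsErgo.vnEntropy_conjDiag] at hSτ
      rw [ht.eq_of_shannon_eq hs (hSτ.trans hS.symm)]
  · have hlin : ObsErgo.energy H (ρ - σ) = ObsErgo.energy H ρ - ObsErgo.energy H σ := by
      simp [ObsErgo.energy, Matrix.mul_sub, Matrix.trace_sub]
    rw [hlin]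
    rw [hdiag, ObsErgo.isThermal_conjDiag_iff] at hσ
    obtain ⟨s, hs, rfl⟩ := hσ
    rw [ObsErgo.vnEntropy_conjDiag] at hS
    have h := ObsErgo.tendsto_obsErgotropy_div W hH.eigenvalues C hρ hs hS
    rw [← ObsErgo.energy_conjDiag_self W, ← hdiag] at h
    exact h
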